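/- Let $N\ge 2$ be an integer, $R>0$, $p>1$, and $B_R=\{x\in\mathbb R^N: |x|<R\}$. Let $W:\mathbb R^N\to\mathbb R$ and $G:\mathbb R\to\mathbb R$ be continuous such that: - (coercivity) there are constants $\nu_1>0$, $C>0$ with $W(\xi)\ge \nu_1|\xi|^p-C$ for all $\xi\in\mathbb R^N$; - (symmetry) $W(\xi)=\tilde W(|\xi|)$ for all $\xi$, where $\tilde W:\mathbb R\to\mathbb R$ is continuous and even; - (growth of $G$) there are constants $C,\nu_3,\nu_4\ge 0$ and $\varrho\in(0,p]$ such that for all $\mu\in\mathbb R$: $G(\mu)\ge-\nu_3|\mu|^{p-\varrho}-C$; if $p<N$, then $G(\mu)\le \nu_4|\mu|^{p^*-\varrho}+C$ with $p^*=\frac{pN}{N-p}$; and if $p=N$, then $G(\mu)\le\nu_4|\mu|^{\tilde p}+C$ for some $\tilde p\in(0,\infty)$ independent of $\mu$. For $u\in W_0^{1,p}(B_R)$ put $$E(u)=\int_{B_R}\big[W(\nabla u)+G(u)\big]\,dx\in(-\infty,+\infty],$$ and let $\partial_r u(x)=\nabla u(x)\cdot\frac{x}{|x|}$. "Minimizer"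 means global minimizer of $E$ in $W_0^{1,p}(B_R)$. A function $u$ on $B_R$ is radially symmetric if $u(x)=f(|x|)$ for a.e. $x\in B_R$ and some $f$. Monotonicity is not strict unless so stated. Suppose that $\tilde W$ is increasing on $[0,\infty)$, that $E$ has a minimizer, and that $M_0\ge0$ is a constant such that $\tilde W$ is constant on $[-M_0,M_0]$ ($M_0=0$ is allowed). Consider the conditions - $(G_2)$: $G$ is decreasing on $[0,\infty)$, and $G(\mu)\le G(-\mu)$ for all $\mu>0$; - $(G_2')$: $G$ is strictly decreasing on $[0,\infty)$, and $G(\mu)\le G(-\mu)$ for all $\mu>0$; - $(*)$ (on a function $u$): for a.e. $x\in B_R$ and every $\nu\in\mathbb R$, $|\nu|>|\partial_r u(x)|$ implies $\tilde W(|\nu|)>\tilde W(|\partial_r u(x)|)$. Then: (i) At least one minimizer $u$ is radially symmetric. If $(G_2)$ holds, there is a radially symmetric minimizer $u$ with $u\ge0$ and $\partial_r u\le -M_0$ a.e. in $B_R$. (ii) Every minimizer $u$ satisfying $(*)$ is radially symmetric. (iii) If $(G_2')$ holds, then every minimizer $u$ satisfies $(*)$ and is radially symmetric. Moreover, either $u\ge0$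 a.e. in $B_R$ or $u\le0$ a.e. in $B_R$. If $u\le 0$ a.e., then $G(u)=G(-u)$ a.e. in $B_R$, and $|u|$ is a minimizer, too. If $u\ge0$ a.e., then $\partial_r u\le-M_0$ a.e. in $B_R$, and $u$ is decreasing in radial direction, i.e. $u(x)=f(|x|)$ for a.e. $x\in B_R$ with some function $f$ that is decreasing on $(0,R)$. -/

import Mathlib

open MeasureTheory Set
open scoped ENNReal ContDiff

namespace RadialMin

noncomputable section

/-- The Euclidean space `ℝ^N`. -/
abbrev Euc (N : ℕ) : Type := EuclideanSpace ℝ (Fin N)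

/-- `φ ∈ C_0^∞(Ω)`: smooth with compact support contained in `Ω`. -/
structure IsTestFunction {N : ℕ} (Ω : Set (Euc N)) (φ : Euc N → ℝ) : Prop where
  smooth : ContDiff ℝ ∞ φ
  compact : HasCompactSupport φ
  support_subset : tsupport φ ⊆ Ω

/-- `g` is a weak gradient of `u` in `Ω`, both being locally integrable on `Ω`. -/
structure HasWeakGrad {N : ℕ} (Ω : Set (Euc N)) (u : Euc N → ℝ) (g : Euc N → Euc N) : Prop where
  locInt : LocallyIntegrableOn u Ω volume
  locInt_grad : LocallyIntegrableOn g Ω volume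
  integral_eq : ∀ φ : Euc N → ℝ, IsTestFunction Ω φ → ∀ e : Euc N,
    ∫ x in Ω, u x * fderiv ℝ φ x e = - ∫ x in Ω, inner ℝ (g x) e * φ x

/-- The weak gradient `∇u` of `u` in `Ω` (determined up to a null set, see
`HasWeakGrad.ae_eq`; `0` if `u` has none). -/
def weakGrad {N : ℕ} (Ω : Set (Euc N)) (u : Euc N → ℝ) : Euc N → Euc N :=
  open Classical in if h : ∃ g, HasWeakGrad Ω u g then h.choose else 0

/-- Weak gradients in an open set are unique up to a null set. -/
theorem HasWeakGrad.ae_eq {N : ℕ} {Ω : Set (Euc N)} (hΩ : IsOpen Ω) {u : Euc N → ℝ}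
    {g h : Euc N → Euc N} (hg : HasWeakGrad Ω u g) (hh : HasWeakGrad Ω u h) :
    g =ᵐ[volume.restrict Ω] h := by
  have key : ∀ᵐ x ∂(volume : Measure (Euc N)), x ∈ Ω → (g - h) x = 0 := by
    refine hΩ.ae_eq_zero_of_integral_contDiff_smul_eq_zero
      (hg.locInt_grad.sub hh.locInt_grad) ?_
    intro φ hφ hc hs
    have hint : ∀ k : Euc N → Euc N, LocallyIntegrableOn k Ω volume →
        Integrable (fun x => φ x • k x) volume := by
      intro k hk
      have h1 : IntegrableOn (fun x => φ x • k x) (tsupport φ) volume :=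
        (hk.integrableOn_compact_subset hs hc).continuousOn_smul
          hφ.continuous.continuousOn hc
      rw [integrableOn_iff_integrable_of_support_subset] at h1
      · exact h1
      · exact (Function.support_smul_subset_left _ _).trans (subset_tsupport φ)
    have hi := hint _ (hg.locInt_grad.sub hh.locInt_grad)
    refine ext_inner_right ℝ fun e => ?_
    rw [inner_zero_left, real_inner_comm, ← integral_inner hi]
    have hset : ∀ k : Euc N → Euc N, ∫ x in Ω, inner ℝ (k x) e * φ x
        = ∫ x, inner ℝ e (φ x • k x) := by
      intro k
      rw [setIntegral_eq_integral_of_forall_compl_eq_zero]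
      · refine integral_congr_ae (Filter.Eventually.of_forall fun x => ?_)
        simp only [inner_smul_right, real_inner_comm e, mul_comm]
      · intro x hx
        rw [image_eq_zero_of_notMem_tsupport fun hx' => hx (hs hx'), mul_zero]
    have h1 := hg.integral_eq φ ⟨hφ, hc, hs⟩ e
    have h2 := hh.integral_eq φ ⟨hφ, hc, hs⟩ e
    rw [h1, neg_inj, hset, hset] at h2
    have h3 : ∀ x, inner ℝ e (φ x • (g - h) x)
        = inner ℝ e (φ x • g x) - inner ℝ e (φ x • h x) := by
      intro x
      rw [Pi.sub_apply, smul_sub, inner_sub_right]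
    simp only [h3]
    rw [integral_sub ((hint _ hg.locInt_grad).const_inner e)
      ((hint _ hh.locInt_grad).const_inner e), h2, sub_self]
  refine (ae_restrict_iff' hΩ.measurableSet).2 ?_
  filter_upwards [key] with x hx hxΩ
  exact sub_eq_zero.1 (hx hxΩ)

/-- The Sobolev space `W^{1,p}(Ω)` (elements given by representatives). -/
def W1p {N : ℕ} (p : ℝ) (Ω : Set (Euc N)) : Set (Euc N → ℝ) :=
  {u | MemLp u (ENNReal.ofReal p) (volume.restrict Ω) ∧
    HasWeakGrad Ω u (weakGrad Ω u) ∧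
    MemLp (weakGrad Ω u) (ENNReal.ofReal p) (volume.restrict Ω)}

/-- `W_0^{1,p}(Ω)`: the closure of `C_0^∞(Ω)` in `W^{1,p}(Ω)`. -/
def W01p {N : ℕ} (p : ℝ) (Ω : Set (Euc N)) : Set (Euc N → ℝ) :=
  {u | u ∈ W1p p Ω ∧ ∀ ε : ℝ≥0∞, 0 < ε → ∃ φ : Euc N → ℝ, IsTestFunction Ω φ ∧
    eLpNorm (fun x => u x - φ x) (ENNReal.ofReal p) (volume.restrict Ω) +
      eLpNorm (fun x => weakGrad Ω u x - gradient φ x) (ENNReal.ofReal p)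
        (volume.restrict Ω) < ε}

/-- The integral over `Ω` of a real function whose negative part is integrable, with values in
the extended reals: integral of the positive part minus integral of the negative part. -/
def extIntegral {N : ℕ} (Ω : Set (Euc N)) (f : Euc N → ℝ) : EReal :=
  ((∫⁻ x in Ω, ENNReal.ofReal (f x) : ℝ≥0∞) : EReal) -
    ((∫⁻ x in Ω, ENNReal.ofReal (- f x) : ℝ≥0∞) : EReal)

/-- `E(u) = ∫_{B_R(0)} [W(∇u) + G(u)] dx`, possibly `+∞` since `W` may grow arbitrarily fast. -/
def energy {N : ℕ} (R : ℝ) (W : Euc N → ℝ) (G : ℝ → ℝ) (u : Euc N → ℝ) : EReal :=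
  extIntegral (Metric.ball 0 R) fun x => W (weakGrad (Metric.ball 0 R) u x) + G (u x)

/-- `u` is a global minimizer of `E` in `W_0^{1,p}(B_R(0))`. -/
def IsMinimizer {N : ℕ} (p R : ℝ) (W : Euc N → ℝ) (G : ℝ → ℝ) (u : Euc N → ℝ) : Prop :=
  u ∈ W01p p (Metric.ball 0 R) ∧
    ∀ v ∈ W01p p (Metric.ball (0 : Euc N) R), energy R W G u ≤ energy R W G v

/-- `∂_r u(x) = ∇u(x) · x/|x|` for `u` on `B_R(0)`. -/
def radialDeriv {N : ℕ} (R : ℝ) (u : Euc N → ℝ) (x : Euc N) : ℝ :=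
  inner ℝ (weakGrad (Metric.ball 0 R) u x) (‖x‖⁻¹ • x)

/-- `u` is radially symmetric on `B_R(0)` (as an equivalence class). -/
def IsRadial {N : ℕ} (R : ℝ) (u : Euc N → ℝ) : Prop :=
  ∃ f : ℝ → ℝ, ∀ᵐ x ∂(volume.restrict (Metric.ball (0 : Euc N) R)), u x = f ‖x‖

/-- `u` is radially symmetric on `B_R(0)` with (non-strictly) decreasing profile on `(0,R)`. -/
def IsRadiallyDecreasing {N : ℕ} (R : ℝ) (u : Euc N → ℝ) : Prop :=
  ∃ f : ℝ → ℝ, AntitoneOn f (Ioo 0 R) ∧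
    ∀ᵐ x ∂(volume.restrict (Metric.ball (0 : Euc N) R)), u x = f ‖x‖

/-- Coercivity: `W(ξ) ≥ ν₁|ξ|^p - C` with positive constants. -/
def Coercive {N : ℕ} (p : ℝ) (W : Euc N → ℝ) : Prop :=
  ∃ ν₁ C : ℝ, 0 < ν₁ ∧ 0 < C ∧ ∀ ξ, ν₁ * ‖ξ‖ ^ p - C ≤ W ξ

/-- Growth of `G`: lower order from below, and subcritical from above if `p ≤ N`. -/
def Growth (N : ℕ) (p : ℝ) (G : ℝ → ℝ) : Prop :=
  ∃ C ν₃ ν₄ ρ : ℝ, 0 ≤ C ∧ 0 ≤ ν₃ ∧ 0 ≤ ν₄ ∧ 0 < ρ ∧ ρ ≤ p ∧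
    (∀ μ, -ν₃ * |μ| ^ (p - ρ) - C ≤ G μ) ∧
    (p < N → ∀ μ, G μ ≤ ν₄ * |μ| ^ (p * N / (N - p) - ρ) + C) ∧
    (p = N → ∃ q : ℝ, 0 < q ∧ ∀ μ, G μ ≤ ν₄ * |μ| ^ q + C)

/-- `G` is decreasing on `[0,∞)` and `G(μ) ≤ G(-μ)` for `μ > 0`. -/
def Shape (G : ℝ → ℝ) : Prop :=
  AntitoneOn G (Ici 0) ∧ ∀ μ, 0 < μ → G μ ≤ G (-μ)

/-- `G` is strictly decreasing on `[0,∞)` and `G(μ) ≤ G(-μ)` for `μ > 0`. -/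
def StrictShape (G : ℝ → ℝ) : Prop :=
  StrictAntiOn G (Ici 0) ∧ ∀ μ, 0 < μ → G μ ≤ G (-μ)

/-- For a.e. `x ∈ B_R(0)` and every `ν`: `|ν| > |∂_r u(x)|` implies `V(|ν|) > V(|∂_r u(x)|)`. -/
def StrictIncreaseAt {N : ℕ} (R : ℝ) (V : ℝ → ℝ) (u : Euc N → ℝ) : Prop :=
  ∀ᵐ x ∂(volume.restrict (Metric.ball (0 : Euc N) R)),
    ∀ ν : ℝ, |radialDeriv R u x| < |ν| → V |radialDeriv R u x| < V |ν|

end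

end RadialMin

/-! Let u be a minimizer with minimum value m. Since `Wt` is increasing and |∂_r u| ≤ |∇u|, dropping
the tangential part of the gradient does not raise the energy, and in polar coordinates the reduced
energy is an integral over directions θ of one-dimensional energies e(θ). The profile of u along the
ray θ, spread radially over the ball, is a competitor with energy A e(θ), where A is the area of the
sphere; so A e(θ) ≥ m. The average of A e(θ) over the sphere is the reduced energy, which is at most
m. Hence both inequalities are equalities: almost every ray yields a radial minimizer, and W(∇u) =
Wt(∂_r u) a.e. (`IsMinimizer.ae_ray`). No convexity of `W` enters.

Under (*) the second equality forces |∇u| = |∂_r u|, so ∇u is radial. A function with radial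
gradient does not change along rotations, hence is radial (`isRadial_of_weakGrad_radial`).

The rest is one-dimensional. A radial minimizer has profile -∫_r^R F. Replacing F by minus its
plateau lift leaves `Wt` unchanged, while the new profile is nonnegative, decreasing and at least
the modulus of the old one, so the `G` term does not increase (`IsMinimizer.lift_profile`); the
level M₀ gives the slope bound. If `G` is strictly decreasing, nothing can have moved
(`IsMinimizer.ae_tail_eq`): |F| is never below a level c with the same value of `Wt`, which for all
rational c is (*); and |∫F| = ∫|F|, which gives a constant sign.

The passage between W_0^{1,p} and ray profiles goes through `radialPrim_mem_W01p` and
`ae_eq_neg_integral_ray`, both proved by approximation with test functions and a weighted Hardy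
inequality. -/

namespace RadialMin

noncomputable section

open Filter Topology

/-! ### Weak gradients and limits of test functions -/

section Closure

variable {N : ℕ} {Ω : Set (Euc N)}

/-- `weakGrad` is an arbitrary choice, so every computation of it goes through uniqueness almost
everywhere. -/
theorem HasWeakGrad.weakGrad_ae_eq (hΩ : IsOpen Ω) {u : Euc N → ℝ} {g : Euc N → Euc N}
    (h : HasWeakGrad Ω u g) : weakGrad Ω u =ᵐ[volume.restrict Ω] g := by
  have h1 : HasWeakGrad Ω u (weakGrad Ω u) := by
    have h2 : ∃ g, HasWeakGrad Ω u g := ⟨g, h⟩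
    unfold weakGrad
    rw [dif_pos h2]
    exact h2.choose_spec
  exact h1.ae_eq hΩ h

theorem locallyIntegrableOn_congr {E : Type*} [NormedAddCommGroup E] {f g : Euc N → E}
    (hf : LocallyIntegrableOn f Ω volume) (h : f =ᵐ[volume.restrict Ω] g) :
    LocallyIntegrableOn g Ω volume := by
  intro x hx
  obtain ⟨t, ht, hft⟩ := hf x hx
  refine ⟨t ∩ Ω, inter_mem ht self_mem_nhdsWithin, ?_⟩
  refine (hft.mono_set inter_subset_left).congr ?_
  exact ae_restrict_of_ae_restrict_of_subset inter_subset_right h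

theorem HasWeakGrad.congr {u v : Euc N → ℝ} {g k : Euc N → Euc N}
    (h : HasWeakGrad Ω u g)
    (huv : u =ᵐ[volume.restrict Ω] v) (hgk : g =ᵐ[volume.restrict Ω] k) :
    HasWeakGrad Ω v k where
  locInt := locallyIntegrableOn_congr h.locInt huv
  locInt_grad := locallyIntegrableOn_congr h.locInt_grad hgk
  integral_eq φ hφ e := by
    rw [← integral_congr_ae (μ := volume.restrict Ω)
        (huv.mono fun x hx => show u x * fderiv ℝ φ x e = v x * fderiv ℝ φ x e by rw [hx]),
      h.integral_eq φ hφ e, integral_congr_ae (μ := volume.restrict Ω)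
        (hgk.mono fun x hx => show inner ℝ (g x) e * φ x = inner ℝ (k x) e * φ x by rw [hx])]

theorem IsTestFunction.contDiff_gradient {φ : Euc N → ℝ} (hφ : IsTestFunction Ω φ) :
    ContDiff ℝ ∞ (gradient φ) := by
  unfold gradient
  exact (InnerProductSpace.toDual ℝ (Euc N)).symm.contDiff.comp
    (hφ.smooth.fderiv_right (m := ∞) (by simp))

theorem IsTestFunction.compact_gradient {φ : Euc N → ℝ} (hφ : IsTestFunction Ω φ) :
    HasCompactSupport (gradient φ) := by
  unfold gradient
  exact (hφ.compact.fderiv (𝕜 := ℝ)).comp_left (by simp)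

theorem IsTestFunction.memLp {φ : Euc N → ℝ} (hφ : IsTestFunction Ω φ) (p : ℝ≥0∞)
    (μ : Measure (Euc N)) [IsFiniteMeasureOnCompacts μ] : MemLp φ p μ :=
  hφ.smooth.continuous.memLp_of_hasCompactSupport hφ.compact

theorem IsTestFunction.memLp_gradient {φ : Euc N → ℝ} (hφ : IsTestFunction Ω φ) (p : ℝ≥0∞)
    (μ : Measure (Euc N)) [IsFiniteMeasureOnCompacts μ] : MemLp (gradient φ) p μ :=
  hφ.contDiff_gradient.continuous.memLp_of_hasCompactSupport hφ.compact_gradient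

theorem IsTestFunction.inner_gradient {φ : Euc N → ℝ} (hφ : IsTestFunction Ω φ) (x e : Euc N) :
    inner ℝ (gradient φ x) e = fderiv ℝ φ x e := by
  have := hφ.smooth.differentiable (by simp)
  exact inner_gradient_left

theorem IsTestFunction.setIntegral_mul {φ : Euc N → ℝ} (hφ : IsTestFunction Ω φ)
    (k : Euc N → ℝ) : ∫ x in Ω, k x * φ x = ∫ x, k x * φ x := by
  refine setIntegral_eq_integral_of_forall_compl_eq_zero fun x hx => ?_
  rw [image_eq_zero_of_notMem_tsupport fun hx' => hx (hφ.support_subset hx'), mul_zero]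

/-- Each side of the identity contains a factor supported in Ω, so both integrals extend to the
whole space, where integration by parts has no boundary term. -/
theorem IsTestFunction.hasWeakGrad {φ : Euc N → ℝ} (hφ : IsTestFunction Ω φ) :
    HasWeakGrad Ω φ (gradient φ) where
  locInt := hφ.smooth.continuous.locallyIntegrable.locallyIntegrableOn _
  locInt_grad := hφ.contDiff_gradient.continuous.locallyIntegrable.locallyIntegrableOn _
  integral_eq η hη e := by
    have h1 : ∫ x in Ω, φ x * fderiv ℝ η x e = ∫ x, φ x * fderiv ℝ η x e := by
      simp_rw [mul_comm (φ _)]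
      exact hφ.setIntegral_mul fun x => fderiv ℝ η x e
    rw [h1, hη.setIntegral_mul fun x => inner ℝ (gradient φ x) e]
    simp_rw [hφ.inner_gradient]
    have hdφ := (hφ.smooth.continuous_fderiv (by simp)).clm_apply (continuous_const (y := e))
    have hdη := (hη.smooth.continuous_fderiv (by simp)).clm_apply (continuous_const (y := e))
    refine integral_mul_fderiv_eq_neg_fderiv_mul_of_integrable ?_ ?_ ?_ ?_ ?_
    · exact (hdφ.mul hη.smooth.continuous).integrable_of_hasCompactSupport hη.compact.mul_left
    · exact (hφ.smooth.continuous.mul hdη).integrable_of_hasCompactSupport hφ.compact.mul_right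
    · exact (hφ.smooth.continuous.mul hη.smooth.continuous).integrable_of_hasCompactSupport
        hη.compact.mul_left
    · exact fun x _ => (hφ.smooth.differentiable (by simp)) x
    · exact fun x _ => (hη.smooth.differentiable (by simp)) x

/-- On a finite measure space, convergence in `L^p` implies convergence in `L^1`. -/
theorem tendsto_eLpNorm_one {α E : Type*} [MeasurableSpace α] [NormedAddCommGroup E]
    {μ : Measure α} [IsFiniteMeasure μ] {p : ℝ≥0∞} (hp : 1 ≤ p) {F : ℕ → α → E}
    (hF : ∀ n, AEStronglyMeasurable (F n) μ)
    (h : Tendsto (fun n => eLpNorm (F n) p μ) atTop (𝓝 0)) :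
    Tendsto (fun n => eLpNorm (F n) 1 μ) atTop (𝓝 0) := by
  have h1 := ENNReal.Tendsto.mul_const (b := μ univ ^ (1 / (1 : ℝ≥0∞).toReal - 1 / p.toReal)) h
    (Or.inr (ENNReal.rpow_ne_top_of_nonneg (by
      rcases eq_or_ne p ∞ with rfl | hp'
      · simp
      · have : 1 ≤ p.toReal := by simpa using ENNReal.toReal_mono hp' hp
        simp only [ENNReal.toReal_one, div_one, one_div, sub_nonneg]
        exact inv_le_one_of_one_le₀ this) (measure_ne_top μ univ)))
  rw [zero_mul] at h1
  exact tendsto_of_tendsto_of_tendsto_of_le_of_le tendsto_const_nhds h1 (fun _ => zero_le)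
    fun n => eLpNorm_le_eLpNorm_mul_rpow_measure_univ hp (hF n)

theorem tendsto_integral_mul_of_eLpNorm_one {α : Type*} [MeasurableSpace α]
    {μ : Measure α} {F : ℕ → α → ℝ} {f h : α → ℝ} (hF : ∀ n, Integrable (F n) μ)
    (hf : Integrable f μ) (hh : AEStronglyMeasurable h μ) {C : ℝ} (hC : ∀ x, ‖h x‖ ≤ C)
    (hlim : Tendsto (fun n => eLpNorm (fun x => f x - F n x) 1 μ) atTop (𝓝 0)) :
    Tendsto (fun n => ∫ x, F n x * h x ∂μ) atTop (𝓝 (∫ x, f x * h x ∂μ)) := by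
  refine tendsto_integral_of_L1' _ (hf.mul_bdd hh (ae_of_all _ hC)).1
    (Eventually.of_forall fun n => (hF n).mul_bdd hh (ae_of_all _ hC)) ?_
  have h1 := ENNReal.Tendsto.const_mul (a := ENNReal.ofReal C) hlim (Or.inr ENNReal.ofReal_ne_top)
  rw [mul_zero] at h1
  refine tendsto_of_tendsto_of_tendsto_of_le_of_le tendsto_const_nhds h1 (fun _ => zero_le) fun n => ?_
  refine eLpNorm_le_mul_eLpNorm_of_ae_le_mul (ae_of_all _ fun x => ?_) 1
  simp only [Pi.sub_apply]
  rw [← sub_mul, norm_mul, norm_sub_rev, mul_comm]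
  exact mul_le_mul_of_nonneg_right (hC x) (norm_nonneg _)

/-- Limits in `W^{1,p}` of test functions belong to `W_0^{1,p}`. -/
theorem mem_W01p_of_approx (hΩ : IsOpen Ω) (hfin : volume Ω ≠ ⊤) {p : ℝ} (hp : 1 ≤ p)
    {u : Euc N → ℝ} {g : Euc N → Euc N}
    (hu : MemLp u (ENNReal.ofReal p) (volume.restrict Ω))
    (hg : MemLp g (ENNReal.ofReal p) (volume.restrict Ω))
    (happ : ∀ ε : ℝ≥0∞, 0 < ε → ∃ φ : Euc N → ℝ, IsTestFunction Ω φ ∧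
      eLpNorm (fun x => u x - φ x) (ENNReal.ofReal p) (volume.restrict Ω) +
        eLpNorm (fun x => g x - gradient φ x) (ENNReal.ofReal p) (volume.restrict Ω) < ε) :
    u ∈ W01p p Ω ∧ weakGrad Ω u =ᵐ[volume.restrict Ω] g := by
  have : IsFiniteMeasure (volume.restrict Ω) := ⟨by simpa using hfin.lt_top⟩
  have hp' : 1 ≤ ENNReal.ofReal p := by simpa using ENNReal.ofReal_le_ofReal hp
  have hu1 := hu.integrable hp'
  have hg1 := hg.integrable hp'
  have hw : HasWeakGrad Ω u g := by
    refine ⟨IntegrableOn.locallyIntegrableOn hu1, IntegrableOn.locallyIntegrableOn hg1,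
      fun η hη e => ?_⟩
    choose φ hφ hφε using fun n : ℕ => happ (n + 1 : ℝ≥0∞)⁻¹ (by simp)
    have hinv : Tendsto (fun n : ℕ => (n + 1 : ℝ≥0∞)⁻¹) atTop (𝓝 0) := by
      have := (tendsto_add_atTop_iff_nat 1).2 ENNReal.tendsto_inv_nat_nhds_zero
      simpa using this
    have hT1 : Tendsto (fun n => eLpNorm (fun x => u x - φ n x) 1 (volume.restrict Ω)) atTop
        (𝓝 0) := by
      refine tendsto_eLpNorm_one hp' (fun n => hu1.1.sub ((hφ n).memLp 1 _).1) ?_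
      exact tendsto_of_tendsto_of_tendsto_of_le_of_le tendsto_const_nhds hinv (fun _ => zero_le)
        fun n => le_self_add.trans (hφε n).le
    have hT2 : Tendsto (fun n => eLpNorm (fun x => inner ℝ (g x) e - inner ℝ (gradient (φ n) x) e)
        1 (volume.restrict Ω)) atTop (𝓝 0) := by
      have h1 : Tendsto (fun n => eLpNorm (fun x => g x - gradient (φ n) x) 1
          (volume.restrict Ω)) atTop (𝓝 0) := by
        refine tendsto_eLpNorm_one hp' (fun n => hg1.1.sub ((hφ n).memLp_gradient 1 _).1) ?_
        exact tendsto_of_tendsto_of_tendsto_of_le_of_le tendsto_const_nhds hinv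
          (fun _ => zero_le) fun n => le_add_self.trans (hφε n).le
      have h2 := ENNReal.Tendsto.const_mul (a := ENNReal.ofReal ‖e‖) h1
        (Or.inr ENNReal.ofReal_ne_top)
      rw [mul_zero] at h2
      refine tendsto_of_tendsto_of_tendsto_of_le_of_le tendsto_const_nhds h2
        (fun _ => zero_le) fun n => ?_
      refine eLpNorm_le_mul_eLpNorm_of_ae_le_mul (ae_of_all _ fun x => ?_) 1
      rw [← inner_sub_left, mul_comm]
      exact norm_inner_le_norm _ _
    obtain ⟨C1, hC1⟩ := (hη.compact.fderiv_apply (𝕜 := ℝ) e).exists_bound_of_continuous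
      ((hη.smooth.continuous_fderiv (by simp)).clm_apply continuous_const)
    obtain ⟨C2, hC2⟩ := hη.compact.exists_bound_of_continuous hη.smooth.continuous
    have hL := tendsto_integral_mul_of_eLpNorm_one
      (fun n => ((hφ n).memLp 1 (volume.restrict Ω)).integrable le_rfl) hu1
      ((hη.smooth.continuous_fderiv (by simp)).clm_apply continuous_const).aestronglyMeasurable
      hC1 hT1
    have hR := tendsto_integral_mul_of_eLpNorm_one
      (fun n => (((hφ n).memLp_gradient 1 (volume.restrict Ω)).integrable le_rfl).inner_const e)
      (hg1.inner_const e) hη.smooth.continuous.aestronglyMeasurable hC2 hT2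
    -- The identity holds for each φ n, and both sides converge because η and its derivative are
    -- bounded.
    refine tendsto_nhds_unique hL (hR.neg.congr fun n => ?_)
    exact ((hφ n).hasWeakGrad.integral_eq η hη e).symm
  have hae := hw.weakGrad_ae_eq hΩ
  refine ⟨⟨⟨hu, hw.congr EventuallyEq.rfl hae.symm,
    (memLp_congr_ae hae).2 hg⟩, fun ε hε => ?_⟩, hae⟩
  obtain ⟨φ, hφ, h⟩ := happ ε hε
  refine ⟨φ, hφ, ?_⟩
  rwa [eLpNorm_congr_ae (hae.mono fun x hx => show weakGrad Ω u x - gradient φ x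
    = g x - gradient φ x by rw [hx])]

/-- Functions here are representatives, and the chosen weak gradients of two representatives may
differ on a null set; this transfers membership and gradient between them. -/
theorem W01p_congr (hΩ : IsOpen Ω) (hfin : volume Ω ≠ ⊤) {p : ℝ} (hp : 1 ≤ p)
    {u v : Euc N → ℝ} (hu : u ∈ W01p p Ω) (h : u =ᵐ[volume.restrict Ω] v) :
    v ∈ W01p p Ω ∧ weakGrad Ω v =ᵐ[volume.restrict Ω] weakGrad Ω u := by
  refine mem_W01p_of_approx hΩ hfin hp ((memLp_congr_ae h).1 hu.1.1) hu.1.2.2 fun ε hε => ?_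
  obtain ⟨φ, hφ, h'⟩ := hu.2 ε hε
  refine ⟨φ, hφ, ?_⟩
  rwa [← eLpNorm_congr_ae (h.mono fun x hx => show u x - φ x = v x - φ x by rw [hx])]

/-- On a set of finite measure L^1 convergence is enough for all later limits, so the exponent is
dropped here. -/
theorem exists_seq_of_mem_W01p (hfin : volume Ω ≠ ⊤) {p : ℝ} (hp : 1 ≤ p)
    {u : Euc N → ℝ} (hu : u ∈ W01p p Ω) :
    ∃ φ : ℕ → Euc N → ℝ, (∀ n, IsTestFunction Ω (φ n)) ∧
      Tendsto (fun n => eLpNorm (fun x => u x - φ n x) 1 (volume.restrict Ω)) atTop (𝓝 0) ∧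
      Tendsto (fun n => eLpNorm (fun x => weakGrad Ω u x - gradient (φ n) x) 1
        (volume.restrict Ω)) atTop (𝓝 0) := by
  have : IsFiniteMeasure (volume.restrict Ω) := ⟨by simpa using hfin.lt_top⟩
  have hp' : 1 ≤ ENNReal.ofReal p := by simpa using ENNReal.ofReal_le_ofReal hp
  choose φ hφ hφε using fun n : ℕ => hu.2 (n + 1 : ℝ≥0∞)⁻¹ (by simp)
  have hinv : Tendsto (fun n : ℕ => (n + 1 : ℝ≥0∞)⁻¹) atTop (𝓝 0) := by
    have := (tendsto_add_atTop_iff_nat 1).2 ENNReal.tendsto_inv_nat_nhds_zero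
    simpa using this
  refine ⟨φ, hφ, ?_, ?_⟩
  · refine tendsto_eLpNorm_one hp' (fun n => hu.1.1.1.sub ((hφ n).memLp 1 _).1) ?_
    exact tendsto_of_tendsto_of_tendsto_of_le_of_le tendsto_const_nhds hinv (fun _ => zero_le)
      fun n => le_self_add.trans (hφε n).le
  · refine tendsto_eLpNorm_one hp' (fun n => hu.1.2.2.1.sub ((hφ n).memLp_gradient 1 _).1) ?_
    exact tendsto_of_tendsto_of_tendsto_of_le_of_le tendsto_const_nhds hinv
      (fun _ => zero_le) fun n => le_add_self.trans (hφε n).le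

end Closure

/-! ### Polar coordinates on the ball -/

section Polar

/-- The measure `s^{N-1} ds` on `(0,R)`. -/
def rayMeasure (N : ℕ) (R : ℝ) : Measure ℝ :=
  (volume.restrict (Ioo 0 R)).withDensity fun s => ENNReal.ofReal (s ^ (N - 1))

/-- The unit sphere of `ℝ^N`. -/
abbrev UnitSphere (N : ℕ) : Type := Metric.sphere (0 : Euc N) 1

/-- The surface measure of the unit sphere. -/
abbrev sphereMeasure (N : ℕ) : Measure (UnitSphere N) :=
  Measure.toSphere (volume : Measure (Euc N))

/-- The area of the unit sphere. -/
abbrev sphereArea (N : ℕ) : ℝ≥0∞ :=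
  sphereMeasure N (univ : Set (UnitSphere N))

variable {N : ℕ} {R : ℝ}

theorem lintegral_rayMeasure (f : ℝ → ℝ≥0∞) :
    ∫⁻ s, f s ∂(rayMeasure N R) = ∫⁻ s in Ioo 0 R, ENNReal.ofReal (s ^ (N - 1)) * f s := by
  rw [rayMeasure, lintegral_withDensity_eq_lintegral_mul_non_measurable _ (by fun_prop)]
  · rfl
  · exact ae_of_all _ fun _ => ENNReal.ofReal_lt_top

instance : IsFiniteMeasure (rayMeasure N R) := by
  refine isFiniteMeasure_withDensity_ofReal (HasFiniteIntegral.of_bounded (C := |R| ^ (N - 1)) ?_)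
  filter_upwards [ae_restrict_mem measurableSet_Ioo] with s hs
  rw [norm_pow, Real.norm_eq_abs]
  exact pow_le_pow_left₀ (abs_nonneg s) (by rw [abs_of_pos hs.1]; exact hs.2.le.trans (le_abs_self R)) _

/-- The density s^{N-1} is positive on (0,R), so the weighted and unweighted measures have the same
null sets. -/
theorem ae_rayMeasure_iff {P : ℝ → Prop} :
    (∀ᵐ s ∂(rayMeasure N R), P s) ↔ ∀ᵐ s ∂(volume.restrict (Ioo 0 R)), P s := by
  rw [rayMeasure, ae_withDensity_iff (by fun_prop)]
  refine ⟨fun h => ?_, fun h => h.mono fun s hs _ => hs⟩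
  filter_upwards [h, ae_restrict_mem measurableSet_Ioo] with s hs hs'
  exact hs (by simpa using pow_pos hs'.1 _)

theorem ae_mem_rayMeasure : ∀ᵐ s ∂(rayMeasure N R), s ∈ Ioo 0 R :=
  ae_rayMeasure_iff.2 (ae_restrict_mem measurableSet_Ioo)

theorem map_volumeIoiPow_restrict (n : ℕ) :
    ((Measure.volumeIoiPow n).restrict (Subtype.val ⁻¹' Iio R)).map Subtype.val
      = (volume.restrict (Ioo 0 R)).withDensity fun s => ENNReal.ofReal (s ^ n) := by
  ext A hA
  rw [Measure.map_apply measurable_subtype_coe hA, Measure.restrict_apply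
    (measurable_subtype_coe hA), ← preimage_inter, Measure.volumeIoiPow,
    withDensity_apply _ (measurable_subtype_coe (hA.inter measurableSet_Iio)),
    setLIntegral_subtype measurableSet_Ioi _ fun a : ℝ ↦ .ofReal (a ^ n),
    withDensity_apply _ hA, Measure.restrict_restrict hA]
  congr 2
  ext s
  simp only [mem_image, mem_preimage, Subtype.exists, mem_Ioi, mem_inter_iff, mem_Iio, mem_Ioo]
  constructor
  · rintro ⟨a, ha, ⟨h1, h2⟩, rfl⟩
    exact ⟨h1, ha, h2⟩
  · rintro ⟨h1, h2, h3⟩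
    exact ⟨s, h2, ⟨h1, h3⟩, rfl⟩

/-- The homeomorphism of the punctured space with sphere × (0,∞) preserves the measures; restrict it
to the ball. Since N ≥ 1, the removed origin is a null set. -/
theorem measurePreserving_polar (hN : 1 ≤ N) :
    MeasurePreserving (fun q : UnitSphere N × ℝ => q.2 • (q.1 : Euc N))
      ((sphereMeasure N).prod (rayMeasure N R)) (volume.restrict (Metric.ball 0 R)) := by
  have : Nonempty (Fin N) := ⟨⟨0, hN⟩⟩
  have h1 := ((volume : Measure (Euc N)).measurePreserving_homeomorphUnitSphereProd).symm
    (homeomorphUnitSphereProd (Euc N)).toMeasurableEquiv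
  have h2 : MeasurePreserving (Subtype.val : ({0}ᶜ : Set (Euc N)) → Euc N)
      (Measure.comap Subtype.val volume) volume := by
    refine ⟨measurable_subtype_coe, ?_⟩
    rw [map_comap_subtype_coe (measurableSet_singleton _).compl, restrict_compl_singleton]
  have h3 := (h2.comp h1).restrict_preimage (measurableSet_ball (x := (0 : Euc N)) (ε := R))
  rw [finrank_euclideanSpace_fin] at h3
  have h4 : (Subtype.val ∘ (homeomorphUnitSphereProd (Euc N)).toMeasurableEquiv.symm) ⁻¹'
      Metric.ball (0 : Euc N) R = univ ×ˢ (Subtype.val ⁻¹' Iio R) := by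
    ext ⟨θ, r⟩
    simp [norm_smul, abs_of_pos (show 0 < (r : ℝ) from r.2)]
  rw [h4, ← Measure.prod_restrict, Measure.restrict_univ] at h3
  refine ⟨by fun_prop, ?_⟩
  rw [rayMeasure, ← map_volumeIoiPow_restrict, ← h3.map_eq]
  have h5 : (sphereMeasure N).prod (((Measure.volumeIoiPow (N - 1)).restrict
      (Subtype.val ⁻¹' Iio R)).map Subtype.val) =
      ((sphereMeasure N).prod ((Measure.volumeIoiPow (N - 1)).restrict
        (Subtype.val ⁻¹' Iio R))).map (Prod.map id Subtype.val) := by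
    rw [← Measure.map_prod_map _ _ measurable_id measurable_subtype_coe, Measure.map_id]
  rw [h5, Measure.map_map (by fun_prop) (by fun_prop)]
  congr 1

theorem measurePreserving_norm (hN : 1 ≤ N) :
    MeasurePreserving (fun x : Euc N => ‖x‖) (volume.restrict (Metric.ball 0 R))
      (sphereArea N • rayMeasure N R) := by
  refine ⟨by fun_prop, ?_⟩
  rw [← (measurePreserving_polar hN).map_eq, Measure.map_map (by fun_prop) (by fun_prop),
    ← Measure.map_snd_prod]
  refine Measure.map_congr ?_
  have h := (Measure.quasiMeasurePreserving_snd (μ := sphereMeasure N)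
    (ν := rayMeasure N R)).ae ae_mem_rayMeasure
  filter_upwards [h] with q hq
  simp [norm_smul, abs_of_pos hq.1]

theorem sphereArea_ne_zero (hN : 1 ≤ N) : sphereArea N ≠ 0 := by
  have : Nonempty (Fin N) := ⟨⟨0, hN⟩⟩
  rw [Ne, Measure.measure_univ_eq_zero]
  exact Measure.toSphere_ne_zero _

theorem ae_polar (hN : 1 ≤ N) {P : Euc N → Prop}
    (h : ∀ᵐ x ∂(volume.restrict (Metric.ball (0 : Euc N) R)), P x) :
    ∀ᵐ θ : UnitSphere N ∂(sphereMeasure N), ∀ᵐ s ∂(rayMeasure N R), P (s • (θ : Euc N)) :=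
  Measure.ae_ae_of_ae_prod ((measurePreserving_polar hN).quasiMeasurePreserving.ae h)

/-- Unlike `ae_polar`, this direction of Fubini needs the set to be measurable. -/
theorem ae_of_ae_polar (hN : 1 ≤ N) {P : Euc N → Prop} (hP : MeasurableSet {x | P x})
    (h : ∀ᵐ θ : UnitSphere N ∂(sphereMeasure N), ∀ᵐ s ∂(rayMeasure N R), P (s • (θ : Euc N))) :
    ∀ᵐ x ∂(volume.restrict (Metric.ball (0 : Euc N) R)), P x := by
  rw [← (measurePreserving_polar hN).map_eq, ae_map_iff (by fun_prop) hP]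
  refine (Measure.ae_prod_iff_ae_ae ?_).2 h
  exact (measurePreserving_polar (N := N) (R := R) hN).measurable hP

theorem ae_norm (hN : 1 ≤ N) {P : ℝ → Prop} (h : ∀ᵐ s ∂(rayMeasure N R), P s) :
    ∀ᵐ x ∂(volume.restrict (Metric.ball (0 : Euc N) R)), P ‖x‖ :=
  (measurePreserving_norm hN).quasiMeasurePreserving.ae (Measure.ae_smul_measure h _)

end Polar

/-! ### A weighted Hardy inequality on (0,R) -/

section Hardy

variable {N : ℕ} {R : ℝ}

/-- A pointwise weighted Hardy inequality on the ray. -/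
theorem pow_mul_lintegral_rpow_le {p : ℝ} (hp : 1 ≤ p) {k : ℝ → ℝ≥0∞} (hk : Measurable k)
    {s : ℝ} (hs : 0 < s) :
    ENNReal.ofReal (s ^ (N - 1)) * (∫⁻ t in Ioo s R, k t) ^ p
      ≤ ENNReal.ofReal R ^ (p - 1) * ∫⁻ t, k t ^ p ∂(rayMeasure N R) := by
  -- Hölder on (s,R), an interval of length at most R, gives the factor R^{p-1}; the weight then
  -- moves inside because s^{N-1} ≤ t^{N-1} for t > s.
  have hp0 : 0 < p := by linarith
  have h1 : (∫⁻ t in Ioo s R, k t) ^ p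
      ≤ (∫⁻ t in Ioo s R, k t ^ p) * ENNReal.ofReal R ^ (p - 1) := by
    have h := eLpNorm'_le_eLpNorm'_mul_rpow_measure_univ (μ := volume.restrict (Ioo s R))
      (f := k) one_pos hp hk.aestronglyMeasurable
    simp only [eLpNorm', enorm_eq_self, ENNReal.rpow_one, div_one, MeasurableSet.univ,
      Measure.restrict_apply, univ_inter, Real.volume_Ioo] at h
    have h2 := ENNReal.rpow_le_rpow h hp0.le
    rw [ENNReal.mul_rpow_of_nonneg _ _ hp0.le, ← ENNReal.rpow_mul, ← ENNReal.rpow_mul,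
      one_div_mul_cancel hp0.ne', ENNReal.rpow_one, sub_mul, one_mul,
      one_div_mul_cancel hp0.ne'] at h2
    refine h2.trans ?_
    gcongr
    linarith
  calc ENNReal.ofReal (s ^ (N - 1)) * (∫⁻ t in Ioo s R, k t) ^ p
      ≤ ENNReal.ofReal (s ^ (N - 1)) *
          ((∫⁻ t in Ioo s R, k t ^ p) * ENNReal.ofReal R ^ (p - 1)) := by gcongr
    _ = ENNReal.ofReal R ^ (p - 1) *
          ∫⁻ t in Ioo s R, ENNReal.ofReal (s ^ (N - 1)) * k t ^ p := by
        rw [lintegral_const_mul' _ _ ENNReal.ofReal_ne_top]; ring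
    _ ≤ ENNReal.ofReal R ^ (p - 1) *
          ∫⁻ t in Ioo s R, ENNReal.ofReal (t ^ (N - 1)) * k t ^ p := by
        refine mul_le_mul_right ?_ _
        refine setLIntegral_mono' measurableSet_Ioo fun t ht => ?_
        gcongr
        exact ht.1.le
    _ ≤ _ := by
        rw [lintegral_rayMeasure]
        gcongr

/-- The pointwise bound has a right-hand side independent of s; integrating it over (0,R) supplies
one more factor R. -/
theorem lintegral_lintegral_tail_rpow_le {p : ℝ} (hp : 1 ≤ p) {k : ℝ → ℝ≥0∞} (hk : Measurable k) :
    ∫⁻ s, (∫⁻ t in Ioo s R, k t) ^ p ∂(rayMeasure N R)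
      ≤ ENNReal.ofReal R ^ p * ∫⁻ t, k t ^ p ∂(rayMeasure N R) := by
  rcases le_or_gt R 0 with hR | hR
  · simp [rayMeasure, Ioo_eq_empty_of_le hR]
  have hR' : ENNReal.ofReal R ≠ 0 := by simpa using hR
  rw [lintegral_rayMeasure (fun s => (∫⁻ t in Ioo s R, k t) ^ p)]
  refine (setLIntegral_mono' measurableSet_Ioo
    fun s hs => pow_mul_lintegral_rpow_le hp hk hs.1).trans ?_
  rw [lintegral_const, Measure.restrict_apply .univ, univ_inter, Real.volume_Ioo, sub_zero,
    mul_right_comm]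
  gcongr
  nth_rewrite 2 [← ENNReal.rpow_one (ENNReal.ofReal R)]
  rw [← ENNReal.rpow_add _ _ hR' ENNReal.ofReal_ne_top, sub_add_cancel]

/-- The variable endpoint is moved into an indicator on the plane, which makes this a parametric
integral. -/
theorem stronglyMeasurable_tail {F : ℝ → ℝ} (hF : Measurable F) :
    StronglyMeasurable fun s => ∫ t in Ioo s R, F t := by
  have h : ∀ s, ∫ t in Ioo s R, F t
      = ∫ t, ({q : ℝ × ℝ | q.1 < q.2 ∧ q.2 < R}.indicator (fun q => F q.2)) (s, t) := by
    intro s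
    rw [← integral_indicator measurableSet_Ioo]
    rfl
  simp_rw [h]
  refine StronglyMeasurable.integral_prod_right ?_
  refine ((hF.comp measurable_snd).indicator ?_).stronglyMeasurable
  exact (measurableSet_lt measurable_fst measurable_snd).inter
    (measurableSet_lt measurable_snd measurable_const)

theorem eLpNorm_tail_le {p : ℝ} (hp : 1 ≤ p) {F : ℝ → ℝ} (hF : Measurable F) :
    eLpNorm (fun s => ∫ t in Ioo s R, F t) (ENNReal.ofReal p) (rayMeasure N R)
      ≤ ENNReal.ofReal R * eLpNorm F (ENNReal.ofReal p) (rayMeasure N R) := by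
  have hp0 : 0 < p := by linarith
  have hp1 : ENNReal.ofReal p ≠ 0 := by simpa using hp0
  rw [eLpNorm_eq_lintegral_rpow_enorm_toReal hp1 ENNReal.ofReal_ne_top,
    eLpNorm_eq_lintegral_rpow_enorm_toReal hp1 ENNReal.ofReal_ne_top, ENNReal.toReal_ofReal hp0.le]
  have h := lintegral_lintegral_tail_rpow_le (N := N) (R := R) hp hF.enorm
  have h2 : ∫⁻ s, ‖∫ t in Ioo s R, F t‖ₑ ^ p ∂(rayMeasure N R)
      ≤ ENNReal.ofReal R ^ p * ∫⁻ t, ‖F t‖ₑ ^ p ∂(rayMeasure N R) := by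
    refine (lintegral_mono fun s => ?_).trans h
    gcongr
    exact enorm_integral_le_lintegral_enorm _
  refine (ENNReal.rpow_le_rpow h2 (by positivity)).trans ?_
  rw [ENNReal.mul_rpow_of_nonneg _ _ (by positivity), ← ENNReal.rpow_mul,
    mul_one_div_cancel hp0.ne', ENNReal.rpow_one]

/-- The case p = 1 of the Hardy bound: away from the origin the weight is bounded below, so the tail
integrals of weighted-integrable functions are genuine. -/
theorem integrableOn_tail {F : ℝ → ℝ} (hF : Integrable F (rayMeasure N R)) (hFm : Measurable F)
    {s : ℝ} (hs : 0 < s) : IntegrableOn F (Ioo s R) := by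
  refine ⟨hFm.aestronglyMeasurable, ?_⟩
  have h := pow_mul_lintegral_rpow_le (N := N) (R := R) le_rfl hFm.enorm hs
  simp only [ENNReal.rpow_one, sub_self, ENNReal.rpow_zero, one_mul] at h
  have h2 := h.trans_lt hF.2
  exact ENNReal.lt_top_of_mul_ne_top_right h2.ne (by simpa using pow_pos hs _)

end Hardy

/-! ### Radial functions in W_0^{1,p} -/

section RadialFunctions

variable {N : ℕ} {R : ℝ}

/-- The radial function with profile `r ↦ -∫_r^R F`. -/
def radialPrim (N : ℕ) (R : ℝ) (F : ℝ → ℝ) (x : Euc N) : ℝ := -∫ t in Ioo ‖x‖ R, F t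

theorem eLpNorm_comp_norm (hN : 1 ≤ N) {p : ℝ≥0∞} (hp : p ≠ ⊤) {f : ℝ → ℝ} (hf : StronglyMeasurable f) :
    eLpNorm (fun x : Euc N => f ‖x‖) p (volume.restrict (Metric.ball 0 R))
      = sphereArea N ^ (1 / p.toReal) * eLpNorm f p (rayMeasure N R) := by
  have h := eLpNorm_comp_measurePreserving (p := p) (g := f) hf.aestronglyMeasurable
    (measurePreserving_norm (N := N) (R := R) hN)
  rw [eLpNorm_smul_measure_of_ne_top hp, smul_eq_mul, one_div, ENNReal.toReal_inv, ← one_div] at h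
  exact h

theorem eLpNorm_radialPrim_le (hN : 1 ≤ N) {p : ℝ} (hp : 1 ≤ p) {F : ℝ → ℝ} (hF : Measurable F) :
    eLpNorm (radialPrim N R F) (ENNReal.ofReal p) (volume.restrict (Metric.ball 0 R))
      ≤ sphereArea N ^ (1 / (ENNReal.ofReal p).toReal) *
        (ENNReal.ofReal R * eLpNorm F (ENNReal.ofReal p) (rayMeasure N R)) := by
  have h := eLpNorm_comp_norm (N := N) (R := R) hN (p := ENNReal.ofReal p) ENNReal.ofReal_ne_top
    (stronglyMeasurable_tail (R := R) hF)
  have h2 : radialPrim N R F = -fun x : Euc N => ∫ t in Ioo ‖x‖ R, F t := rfl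
  rw [h2, eLpNorm_neg, h]
  gcongr
  exact eLpNorm_tail_le hp hF

/-- Approximate by a smooth compactly supported g on the line, then cut off near both endpoints; g
is bounded and the strips removed have small measure. -/
theorem exists_smooth_approx {p : ℝ} (hp : 1 ≤ p) (hR : 0 < R) {F : ℝ → ℝ}
    (hF : MemLp F (ENNReal.ofReal p) (rayMeasure N R)) {ε : ℝ≥0∞} (hε : 0 < ε) :
    ∃ (ψ : ℝ → ℝ) (a b : ℝ), ContDiff ℝ ∞ ψ ∧ 0 < a ∧ b < R ∧ (∀ t ∉ Icc a b, ψ t = 0) ∧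
      eLpNorm (fun s => F s - ψ s) (ENNReal.ofReal p) (rayMeasure N R) < ε := by
  have hp' : 1 ≤ ENNReal.ofReal p := by simpa using ENNReal.ofReal_le_ofReal hp
  have hp1 : ENNReal.ofReal p ≠ 0 := (zero_lt_one.trans_le hp').ne'
  obtain ⟨δ, hδ, hδε⟩ := ENNReal.lt_iff_exists_nnreal_btwn.1 (ENNReal.half_pos hε.ne')
  have hδ' : 0 < (δ : ℝ) := by simpa using hδ
  obtain ⟨g, hgc, hgs, hg⟩ := hF.exist_eLpNorm_sub_le ENNReal.ofReal_ne_top hp' hδ'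
  obtain ⟨C, hC⟩ := hgc.exists_bound_of_continuous hgs.continuous
  -- The closed ball is [d, R - d] with d = R/(2(n+2)); the 2 added to n keeps d < R/2 already for n
  -- = 0.
  set A : ℕ → Set ℝ := fun n => Ioo 0 R \ Metric.closedBall (R / 2) (R / 2 - R / (2 * (n + 2)))
  have hmono : ∀ n m : ℕ, n ≤ m → R / (2 * ((m : ℝ) + 2)) ≤ R / (2 * ((n : ℝ) + 2)) := by
    intro n m hnm
    gcongr
  have hlim : Tendsto (fun n => rayMeasure N R (A n)) atTop (𝓝 0) := by
    have h1 : ⋂ n, A n = ∅ := by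
      refine eq_empty_of_forall_notMem fun s hs => ?_
      have hs' := mem_iInter.1 hs
      have hs0 : s ∈ Ioo 0 R := (hs' 0).1
      have h2 : |s - R / 2| < R / 2 := by
        rw [abs_lt]; constructor <;> linarith [hs0.1, hs0.2]
      have h3 : Tendsto (fun n : ℕ => R / (2 * ((n : ℝ) + 2))) atTop (𝓝 0) := by
        refine Tendsto.div_atTop tendsto_const_nhds ?_
        exact Tendsto.const_mul_atTop two_pos
          (tendsto_atTop_add_const_right _ _ tendsto_natCast_atTop_atTop)
      obtain ⟨n, hn⟩ := (h3.eventually_lt_const (sub_pos.2 h2)).exists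
      refine (hs' n).2 ?_
      rw [Metric.mem_closedBall, Real.dist_eq]
      linarith
    rw [← measure_empty (μ := rayMeasure N R), ← h1]
    refine tendsto_measure_iInter_atTop (fun n => ?_) (fun n m hnm => ?_) ⟨0, measure_ne_top _ _⟩
    · exact (measurableSet_Ioo.diff measurableSet_closedBall).nullMeasurableSet
    · refine sdiff_subset_sdiff_right (Metric.closedBall_subset_closedBall ?_)
      linarith [hmono n m hnm]
  have hlim2 : Tendsto (fun n => ENNReal.ofReal C *
      rayMeasure N R (A n) ^ (1 / (ENNReal.ofReal p).toReal)) atTop (𝓝 0) := by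
    have hpp : 0 < 1 / (ENNReal.ofReal p).toReal :=
      one_div_pos.2 (ENNReal.toReal_pos hp1 ENNReal.ofReal_ne_top)
    have h := ENNReal.Tendsto.const_mul (a := ENNReal.ofReal C)
      (hlim.ennrpow_const (1 / (ENNReal.ofReal p).toReal)) (Or.inr ENNReal.ofReal_ne_top)
    rwa [ENNReal.zero_rpow_of_pos hpp, mul_zero] at h
  obtain ⟨n, hn⟩ := (hlim2.eventually_lt_const (ENNReal.half_pos hε.ne')).exists
  have hd0 : 0 < R / (2 * ((n : ℝ) + 2)) := by positivity
  have hd1 : R / (2 * ((n : ℝ) + 2)) < R / 2 := by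
    refine div_lt_div_of_pos_left hR two_pos ?_
    have : (0 : ℝ) ≤ n := n.cast_nonneg
    linarith
  set d := R / (2 * ((n : ℝ) + 2)) with hd
  -- χ is 1 on [d, R - d] and vanishes outside (d/2, R - d/2).
  let χ : ContDiffBump (R / 2) := ⟨R / 2 - d, R / 2 - d / 2, by linarith, by linarith⟩
  refine ⟨fun s => χ s * g s, d / 2, R - d / 2, χ.contDiff.mul hgs, by linarith, by linarith,
    fun t ht => ?_, ?_⟩
  · have : χ t = 0 := by
      refine χ.zero_of_le_dist ?_
      show R / 2 - d / 2 ≤ dist t (R / 2)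
      by_contra! h
      rw [Real.dist_eq, abs_lt] at h
      exact ht ⟨by linarith, by linarith⟩
    simp only [this, zero_mul]
  · have e1 : (fun s => F s - χ s * g s) = (F - g) + fun s => (1 - χ s) * g s := by
      ext s; simp only [Pi.add_apply, Pi.sub_apply]; ring
    have m1 : AEStronglyMeasurable (F - g) (rayMeasure N R) :=
      hF.1.sub hgs.continuous.aestronglyMeasurable
    have m2 : AEStronglyMeasurable (fun s => (1 - χ s) * g s) (rayMeasure N R) :=
      ((continuous_const.sub χ.continuous).mul hgs.continuous).aestronglyMeasurable
    rw [e1]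
    refine (eLpNorm_add_le m1 m2 hp').trans_lt ?_
    rw [← ENNReal.add_halves ε]
    refine ENNReal.add_lt_add (hg.trans_lt ?_) ?_
    · rwa [ENNReal.ofReal_coe_nnreal]
    · refine lt_of_le_of_lt ?_ hn
      have hA : MeasurableSet (A n) := measurableSet_Ioo.diff measurableSet_closedBall
      have h5 : eLpNorm (fun s => (1 - χ s) * g s) (ENNReal.ofReal p) (rayMeasure N R)
          ≤ eLpNorm ((A n).indicator fun _ => C) (ENNReal.ofReal p) (rayMeasure N R) := by
        refine eLpNorm_mono_ae_real ?_
        filter_upwards [ae_mem_rayMeasure] with s hs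
        by_cases hsA : s ∈ A n
        · rw [indicator_of_mem hsA, norm_mul, Real.norm_eq_abs,
            abs_of_nonneg (sub_nonneg.2 χ.le_one)]
          refine (mul_le_of_le_one_left (norm_nonneg _) ?_).trans (hC s)
          linarith [χ.nonneg (x := s)]
        · have hs2 : s ∈ Metric.closedBall (R / 2) (R / 2 - d) := by
            by_contra h; exact hsA ⟨hs, h⟩
          rw [χ.one_of_mem_closedBall hs2, sub_self, zero_mul, norm_zero,
            indicator_of_notMem hsA]
      have hC0 : 0 ≤ C := (norm_nonneg _).trans (hC 0)
      refine h5.trans ?_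
      rw [eLpNorm_indicator_const hA hp1 ENNReal.ofReal_ne_top,
        Real.enorm_of_nonneg hC0]

theorem tail_eq_intervalIntegral {ψ : ℝ → ℝ} {a b : ℝ} (hb : b < R)
    (h0 : ∀ t ∉ Icc a b, ψ t = 0) (r : ℝ) : -∫ t in Ioo r R, ψ t = ∫ t in R..r, ψ t := by
  rw [intervalIntegral.integral_symm]
  congr 1
  rcases le_total r R with h | h
  · rw [intervalIntegral.integral_of_le h, integral_Ioc_eq_integral_Ioo]
  · rw [Ioo_eq_empty_of_le h, intervalIntegral.integral_of_ge h]
    simp only [Measure.restrict_empty, integral_zero_measure]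
    rw [setIntegral_eq_zero_of_forall_eq_zero, neg_zero]
    intro t ht
    exact h0 t fun h' => by linarith [h'.2, ht.1]

/-- Since ψ vanishes near 0, the profile is constant there and the singularity of the norm at the
origin is harmless; since ψ vanishes beyond b < R, the support is compact in the ball. -/
theorem isTestFunction_radialPrim {ψ : ℝ → ℝ} {a b : ℝ} (hψ : ContDiff ℝ ∞ ψ)
    (ha : 0 < a) (hb : b < R) (h0 : ∀ t ∉ Icc a b, ψ t = 0) :
    IsTestFunction (Metric.ball 0 R) (radialPrim N R ψ) ∧
      ∀ x, gradient (radialPrim N R ψ) x = ψ ‖x‖ • (‖x‖⁻¹ • x) := by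
  set H : ℝ → ℝ := fun r => ∫ t in R..r, ψ t with hH
  have hv : radialPrim N R ψ = fun x => H ‖x‖ := by
    ext x; exact tail_eq_intervalIntegral hb h0 _
  have hd : ∀ r, HasDerivAt H (ψ r) r := fun r =>
    hψ.continuous.integral_hasStrictDerivAt R r |>.hasDerivAt
  have hHs : ContDiff ℝ ∞ H := by
    rw [contDiff_infty_iff_deriv]
    refine ⟨fun r => (hd r).differentiableAt, ?_⟩
    have : deriv H = ψ := funext fun r => (hd r).deriv
    rwa [this]
  have hconst : ∀ r < a, H r = H 0 := by
    intro r hr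
    have : ∫ t in (0 : ℝ)..r, ψ t = 0 := by
      refine (intervalIntegral.integral_congr (g := fun _ => 0) fun t ht => ?_).trans (by simp)
      refine h0 t fun h' => ?_
      have : t ≤ max 0 r := ht.2
      have : max 0 r < a := max_lt ha hr
      linarith [h'.1]
    have h2 := intervalIntegral.integral_add_adjacent_intervals
      (hψ.continuous.intervalIntegrable (μ := volume) R 0) (hψ.continuous.intervalIntegrable 0 r)
    rw [this, add_zero] at h2
    exact h2.symm
  have hzero : ∀ r, b < r → H r = 0 := by
    intro r hr
    refine (intervalIntegral.integral_congr (g := fun _ => 0) fun t ht => ?_).trans (by simp)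
    refine h0 t fun h' => ?_
    have : min R r ≤ t := ht.1
    have : b < min R r := lt_min hb hr
    linarith [h'.2]
  have hnear : ∀ x : Euc N, x = 0 → (fun x : Euc N => H ‖x‖) =ᶠ[𝓝 x] fun _ => H 0 := by
    rintro x rfl
    filter_upwards [Metric.ball_mem_nhds (0 : Euc N) ha] with y hy
    exact hconst _ (by simpa using hy)
  have hsupp : tsupport (fun x : Euc N => H ‖x‖) ⊆ Metric.closedBall 0 b := by
    refine closure_minimal (fun x hx => ?_) Metric.isClosed_closedBall
    by_contra h
    refine hx (hzero _ ?_)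
    simpa using h
  rw [hv]
  refine ⟨⟨?_, ?_, ?_⟩, fun x => ?_⟩
  · rw [contDiff_iff_contDiffAt]
    intro x
    by_cases hx : x = 0
    · exact contDiffAt_const.congr_of_eventuallyEq (hnear x hx)
    · exact hHs.contDiffAt.comp x (contDiffAt_norm ℝ hx)
  · exact (isCompact_closedBall _ _).of_isClosed_subset (isClosed_tsupport _) hsupp
  · exact hsupp.trans (Metric.closedBall_subset_ball hb)
  · by_cases hx : x = 0
    -- At the origin the function is locally constant, and the right-hand side is 0 as well because
    -- the vector x is.
    · rw [(hnear x hx).gradient_eq, gradient_fun_const, hx]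
      simp
    · refine HasGradientAt.gradient ?_
      rw [hasGradientAt_iff_hasFDerivAt]
      have h1 := (hd ‖x‖).comp_hasFDerivAt x (hasStrictFDerivAt_norm_sq x |>.hasFDerivAt.sqrt
        (by simpa using hx) |>.congr_of_eventuallyEq
          (Eventually.of_forall fun y => (Real.sqrt_sq (norm_nonneg y)).symm))
      refine h1.congr_fderiv ?_
      ext y
      simp only [Real.sqrt_sq (norm_nonneg x), InnerProductSpace.toDual_apply_apply,
        smul_apply, innerSL_apply_apply, smul_eq_mul, real_inner_smul_left]
      have : ‖x‖ ≠ 0 := by simpa using hx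
      field_simp
      simp
      ring

/-- Radial functions with profile in the weighted Sobolev space belong to `W_0^{1,p}(B_R)`. -/
theorem radialPrim_mem_W01p (hN : 1 ≤ N) (hR : 0 < R) {p : ℝ} (hp : 1 ≤ p) {F : ℝ → ℝ}
    (hFm : Measurable F) (hF : MemLp F (ENNReal.ofReal p) (rayMeasure N R)) :
    radialPrim N R F ∈ W01p p (Metric.ball 0 R) ∧
      weakGrad (Metric.ball 0 R) (radialPrim N R F)
        =ᵐ[volume.restrict (Metric.ball 0 R)] fun x => F ‖x‖ • (‖x‖⁻¹ • x) := by
  have hp' : 1 ≤ ENNReal.ofReal p := by simpa using ENNReal.ofReal_le_ofReal hp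
  have hc : sphereArea N ^ (1 / (ENNReal.ofReal p).toReal) ≠ ⊤ :=
    ENNReal.rpow_ne_top_of_nonneg (by positivity) (measure_ne_top _ _)
  have hle : ∀ k : ℝ → ℝ, Measurable k →
      eLpNorm (fun x : Euc N => k ‖x‖ • (‖x‖⁻¹ • x)) (ENNReal.ofReal p)
        (volume.restrict (Metric.ball 0 R)) ≤
      sphereArea N ^ (1 / (ENNReal.ofReal p).toReal) *
        eLpNorm k (ENNReal.ofReal p) (rayMeasure N R) := by
    intro k hk
    rw [← eLpNorm_comp_norm hN ENNReal.ofReal_ne_top hk.stronglyMeasurable]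
    refine eLpNorm_mono fun x => ?_
    rw [norm_smul]
    refine mul_le_of_le_one_right (norm_nonneg _) ?_
    rw [norm_smul, norm_inv, norm_norm]
    exact inv_mul_le_one
  have hmem : MemLp (radialPrim N R F) (ENNReal.ofReal p) (volume.restrict (Metric.ball 0 R)) := by
    refine ⟨?_, (eLpNorm_radialPrim_le hN hp hFm).trans_lt ?_⟩
    · exact ((stronglyMeasurable_tail hFm).comp_measurable
        (measurable_norm (α := Euc N))).neg.aestronglyMeasurable
    · exact ENNReal.mul_lt_top hc.lt_top (ENNReal.mul_lt_top ENNReal.ofReal_lt_top hF.2)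
  have hgmem : MemLp (fun x : Euc N => F ‖x‖ • (‖x‖⁻¹ • x)) (ENNReal.ofReal p)
      (volume.restrict (Metric.ball 0 R)) := by
    refine ⟨?_, (hle F hFm).trans_lt (ENNReal.mul_lt_top hc.lt_top hF.2)⟩
    have : Measurable fun x : Euc N => F ‖x‖ • (‖x‖⁻¹ • x) := by fun_prop
    exact this.aestronglyMeasurable
  refine mem_W01p_of_approx Metric.isOpen_ball measure_ball_lt_top.ne hp hmem hgmem
    fun ε hε => ?_
  -- The summand R is the Hardy constant for the function, the summand 1 accounts for the gradient.
  set K := sphereArea N ^ (1 / (ENNReal.ofReal p).toReal) * (ENNReal.ofReal R + 1) with hK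
  have hKtop : K ≠ ⊤ := ENNReal.mul_ne_top hc (by simp)
  have hK0 : K ≠ 0 := by
    refine mul_ne_zero ?_ (by simp)
    rw [Ne, ENNReal.rpow_eq_zero_iff]
    have := sphereArea_ne_zero hN
    have := measure_ne_top (sphereMeasure N) univ
    tauto
  obtain ⟨ψ, a, b, hψ, ha, hb, h0, hε'⟩ := exists_smooth_approx hp hR hF
    (ENNReal.div_pos hε.ne' hKtop)
  obtain ⟨htest, hgrad⟩ := isTestFunction_radialPrim (N := N) hψ ha hb h0
  refine ⟨_, htest, ?_⟩
  have hm : Measurable fun s => F s - ψ s := hFm.sub hψ.continuous.measurable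
  -- Linearity of the tail integral needs integrability on (‖x‖,R), which is available for x ≠ 0.
  have e1 : ∀ᵐ x ∂(volume.restrict (Metric.ball (0 : Euc N) R)),
      radialPrim N R F x - radialPrim N R ψ x = radialPrim N R (fun s => F s - ψ s) x := by
    filter_upwards [ae_norm hN ae_mem_rayMeasure] with x hx
    have i1 := integrableOn_tail (hF.integrable hp') hFm hx.1
    have i2 : IntegrableOn ψ (Ioo ‖x‖ R) :=
      (hψ.continuous.integrableOn_Icc (μ := volume)).mono_set Ioo_subset_Icc_self
    unfold radialPrim
    rw [integral_sub i1 i2]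
    ring
  have e2 : (fun x => F ‖x‖ • (‖x‖⁻¹ • x) - gradient (radialPrim N R ψ) x)
      = fun x : Euc N => (F ‖x‖ - ψ ‖x‖) • (‖x‖⁻¹ • x) := by
    ext1 x; rw [hgrad, sub_smul]
  rw [eLpNorm_congr_ae e1, e2]
  calc _ ≤ sphereArea N ^ (1 / (ENNReal.ofReal p).toReal) *
        (ENNReal.ofReal R * eLpNorm (fun s => F s - ψ s) (ENNReal.ofReal p) (rayMeasure N R)) +
      sphereArea N ^ (1 / (ENNReal.ofReal p).toReal) *
        eLpNorm (fun s => F s - ψ s) (ENNReal.ofReal p) (rayMeasure N R) :=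
        add_le_add (eLpNorm_radialPrim_le hN hp hm) (hle _ hm)
    _ = K * eLpNorm (fun s => F s - ψ s) (ENNReal.ofReal p) (rayMeasure N R) := by
        rw [hK]; ring
    _ < K * (ε / K) := (ENNReal.mul_lt_mul_iff_right hK0 hKtop).2 hε'
    _ = ε := ENNReal.mul_div_cancel hK0 hKtop

end RadialFunctions

/-! ### Restriction of Sobolev functions to rays -/

section Rays

variable {N : ℕ} {R : ℝ}

theorem lintegral_polar (hN : 1 ≤ N) {k : Euc N → ℝ≥0∞} (hk : Measurable k) :
    ∫⁻ θ : UnitSphere N, ∫⁻ s, k (s • (θ : Euc N)) ∂(rayMeasure N R) ∂(sphereMeasure N)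
      = ∫⁻ x in Metric.ball 0 R, k x := by
  rw [← (measurePreserving_polar hN).lintegral_comp hk,
    lintegral_prod _ (by fun_prop)]

theorem ae_memLp_ray (hN : 1 ≤ N) {p : ℝ} (hp : 1 ≤ p) {F : Euc N → ℝ} (hFm : Measurable F)
    (hF : MemLp F (ENNReal.ofReal p) (volume.restrict (Metric.ball 0 R))) :
    ∀ᵐ θ : UnitSphere N ∂(sphereMeasure N),
      MemLp (fun s : ℝ => F (s • (θ : Euc N))) (ENNReal.ofReal p) (rayMeasure N R) := by
  have hp0 : 0 < p := by linarith
  have hp1 : ENNReal.ofReal p ≠ 0 := by simpa using hp0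
  have h := (eLpNorm_lt_top_iff_lintegral_rpow_enorm_lt_top hp1 ENNReal.ofReal_ne_top).1 hF.2
  rw [← lintegral_polar hN (by fun_prop)] at h
  have hm : Measurable fun q : UnitSphere N × ℝ =>
      ‖F (q.2 • (q.1 : Euc N))‖ₑ ^ (ENNReal.ofReal p).toReal := by fun_prop
  filter_upwards [ae_lt_top (hm.lintegral_prod_right' (ν := rayMeasure N R)) h.ne] with θ hθ
  refine ⟨Measurable.aestronglyMeasurable (by fun_prop), ?_⟩
  exact (eLpNorm_lt_top_iff_lintegral_rpow_enorm_lt_top hp1 ENNReal.ofReal_ne_top).2 hθ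

theorem abs_inner_unit_le (v x : Euc N) : |inner ℝ v (‖x‖⁻¹ • x)| ≤ ‖v‖ := by
  refine (abs_real_inner_le_norm _ _).trans (mul_le_of_le_one_right (norm_nonneg _) ?_)
  rw [norm_smul, norm_inv, norm_norm]
  exact inv_mul_le_one

theorem IsTestFunction.eq_neg_integral_ray {φ : Euc N → ℝ}
    (hφ : IsTestFunction (Metric.ball 0 R) φ) (θ : UnitSphere N) {s : ℝ} (hs : s ∈ Ioo 0 R) :
    φ (s • (θ : Euc N)) = -∫ t in Ioo s R, inner ℝ (gradient φ (t • (θ : Euc N))) (θ : Euc N) := by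
  have hθ : ‖(θ : Euc N)‖ = 1 := norm_eq_of_mem_sphere θ
  have h1 : ∀ t : ℝ, HasDerivAt (fun t : ℝ => φ (t • (θ : Euc N)))
      (inner ℝ (gradient φ (t • (θ : Euc N))) (θ : Euc N)) t := by
    intro t
    rw [hφ.inner_gradient]
    have h2 : HasDerivAt (fun t : ℝ => t • (θ : Euc N)) (θ : Euc N) t := by
      simpa using (hasDerivAt_id t).smul_const (θ : Euc N)
    exact ((hφ.smooth.differentiable (by simp)) _).hasFDerivAt.comp_hasDerivAt t h2
  have hc : Continuous fun t : ℝ => inner ℝ (gradient φ (t • (θ : Euc N))) (θ : Euc N) :=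
    (hφ.contDiff_gradient.continuous.comp (by fun_prop)).inner continuous_const
  have h3 := intervalIntegral.integral_eq_sub_of_hasDerivAt (a := s) (b := R)
    (fun t _ => h1 t) (hc.intervalIntegrable _ _)
  have h4 : φ (R • (θ : Euc N)) = 0 := by
    refine image_eq_zero_of_notMem_tsupport fun h => ?_
    have := hφ.support_subset h
    rw [Metric.mem_ball, dist_zero_right, norm_smul, hθ, mul_one, Real.norm_eq_abs,
      abs_of_pos (hs.1.trans hs.2)] at this
    exact lt_irrefl _ this
  rw [intervalIntegral.integral_of_le hs.2.le, integral_Ioc_eq_integral_Ioo, h4] at h3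
  rw [h3]
  ring

/-- Functions in `W_0^{1,p}(B_R)` are, along almost every ray, the primitive of their radial
derivative vanishing at the boundary. -/
theorem ae_eq_neg_integral_ray (hN : 1 ≤ N) {p : ℝ} (hp : 1 ≤ p) {u F : Euc N → ℝ}
    (hu : u ∈ W01p p (Metric.ball 0 R)) (hFm : Measurable F)
    (hF : radialDeriv R u =ᵐ[volume.restrict (Metric.ball 0 R)] F) :
    ∀ᵐ θ : UnitSphere N ∂(sphereMeasure N), ∀ᵐ s ∂(rayMeasure N R),
      u (s • (θ : Euc N)) = -∫ t in Ioo s R, F (t • (θ : Euc N)) := by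
  have hp' : 1 ≤ ENNReal.ofReal p := by simpa using ENNReal.ofReal_le_ofReal hp
  have hfin : volume (Metric.ball (0 : Euc N) R) ≠ ⊤ := measure_ball_lt_top.ne
  have : IsFiniteMeasure ((volume : Measure (Euc N)).restrict (Metric.ball 0 R)) :=
    ⟨by simpa using hfin.lt_top⟩
  have hg1 : Integrable (weakGrad (Metric.ball 0 R) u) (volume.restrict (Metric.ball 0 R)) :=
    hu.1.2.2.integrable hp'
  have hF1 : Integrable F (volume.restrict (Metric.ball 0 R)) := by
    refine hg1.mono hFm.aestronglyMeasurable ?_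
    filter_upwards [hF] with x hx
    rw [← hx]
    exact abs_inner_unit_le _ _
  obtain ⟨φ, hφ, hφ1, hφ2⟩ := exists_seq_of_mem_W01p hfin hp hu
  have hum := hu.1.1.1
  -- A measurable representative is needed for Tonelli on sphere × ray.
  set v := hum.mk u with hv
  have hvm : Measurable v := hum.stronglyMeasurable_mk.measurable
  have huv : u =ᵐ[volume.restrict (Metric.ball 0 R)] v := hum.ae_eq_mk
  have hTm : Measurable fun q : UnitSphere N × ℝ => ∫ t in Ioo q.2 R, F (t • (q.1 : Euc N)) := by
    have h : ∀ q : UnitSphere N × ℝ, ∫ t in Ioo q.2 R, F (t • (q.1 : Euc N))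
        = ∫ t, ({q : (UnitSphere N × ℝ) × ℝ | q.1.2 < q.2 ∧ q.2 < R}.indicator
          (fun q => F (q.2 • (q.1.1 : Euc N)))) (q, t) := by
      intro q
      rw [← integral_indicator measurableSet_Ioo]
      rfl
    simp_rw [h]
    refine (StronglyMeasurable.integral_prod_right ?_).measurable
    refine (Measurable.indicator (by fun_prop) ?_).stronglyMeasurable
    exact (measurableSet_lt (by fun_prop) measurable_snd).inter
      (measurableSet_lt measurable_snd measurable_const)
  -- D measures the failure of the claimed formula; it vanishes for test functions, so its total
  -- integral is controlled by the approximation errors.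
  set D : UnitSphere N × ℝ → ℝ≥0∞ := fun q =>
    ‖v (q.2 • (q.1 : Euc N)) + ∫ t in Ioo q.2 R, F (t • (q.1 : Euc N))‖ₑ with hD
  have hDm : Measurable D := by
    refine Measurable.enorm (Measurable.add ?_ hTm)
    fun_prop
  have hbound : ∀ n, ∫⁻ θ, ∫⁻ s, D (θ, s) ∂(rayMeasure N R) ∂(sphereMeasure N)
      ≤ eLpNorm (fun x => u x - φ n x) 1 (volume.restrict (Metric.ball 0 R)) +
        ENNReal.ofReal R * eLpNorm (fun x => weakGrad (Metric.ball 0 R) u x - gradient (φ n) x) 1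
        (volume.restrict (Metric.ball 0 R)) := by
    intro n
    have hφm : Measurable (φ n) := (hφ n).smooth.continuous.measurable
    have hgm : Measurable (gradient (φ n)) := (hφ n).contDiff_gradient.continuous.measurable
    set d : Euc N → ℝ := fun x => inner ℝ (gradient (φ n) x) (‖x‖⁻¹ • x) with hd
    have hdm : Measurable d := by
      refine Measurable.inner hgm ?_
      fun_prop
    have i1 : ∫⁻ θ : UnitSphere N, ∫⁻ s, ‖v (s • (θ : Euc N)) - φ n (s • (θ : Euc N))‖ₑ
        ∂(rayMeasure N R) ∂(sphereMeasure N)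
        = eLpNorm (fun x => u x - φ n x) 1 (volume.restrict (Metric.ball 0 R)) := by
      rw [lintegral_polar hN (k := fun x => ‖v x - φ n x‖ₑ) (by fun_prop),
        eLpNorm_one_eq_lintegral_enorm]
      refine lintegral_congr_ae ?_
      filter_upwards [huv] with x hx
      rw [hx]
    have i2 : ∫⁻ θ : UnitSphere N, ∫⁻ s, ‖F (s • (θ : Euc N)) - d (s • (θ : Euc N))‖ₑ
        ∂(rayMeasure N R) ∂(sphereMeasure N)
        ≤ eLpNorm (fun x => weakGrad (Metric.ball 0 R) u x - gradient (φ n) x) 1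
        (volume.restrict (Metric.ball 0 R)) := by
      rw [lintegral_polar hN (k := fun x => ‖F x - d x‖ₑ) (by fun_prop),
        eLpNorm_one_eq_lintegral_enorm]
      refine lintegral_mono_ae ?_
      filter_upwards [hF] with x hx
      rw [← hx, hd, radialDeriv, ← inner_sub_left, enorm_le_iff_norm_le]
      exact abs_inner_unit_le _ _
    have hray : ∀ᵐ θ : UnitSphere N ∂(sphereMeasure N), ∫⁻ s, D (θ, s) ∂(rayMeasure N R)
        ≤ ∫⁻ s, ‖v (s • (θ : Euc N)) - φ n (s • (θ : Euc N))‖ₑ ∂(rayMeasure N R) +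
          ENNReal.ofReal R * ∫⁻ s, ‖F (s • (θ : Euc N)) - d (s • (θ : Euc N))‖ₑ
            ∂(rayMeasure N R) := by
      have hFr := ae_memLp_ray hN le_rfl hFm (R := R)
        (by rw [ENNReal.ofReal_one]; exact memLp_one_iff_integrable.2 hF1)
      filter_upwards [hFr] with θ hθ
      rw [ENNReal.ofReal_one, memLp_one_iff_integrable] at hθ
      have hθ1 : ‖(θ : Euc N)‖ = 1 := norm_eq_of_mem_sphere θ
      have hk : Measurable fun s : ℝ => ‖F (s • (θ : Euc N)) - d (s • (θ : Euc N))‖ₑ := by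
        fun_prop
      -- The case p = 1 bounds the tails of the error in the radial derivative by that error itself.
      have hH := lintegral_lintegral_tail_rpow_le (N := N) (R := R) le_rfl hk
      simp only [ENNReal.rpow_one] at hH
      refine le_trans ?_ (add_le_add_right hH _)
      rw [← lintegral_add_left (by fun_prop)]
      refine lintegral_mono_ae ?_
      filter_upwards [ae_mem_rayMeasure] with s hs
      have e1 : φ n (s • (θ : Euc N)) = -∫ t in Ioo s R, d (t • (θ : Euc N)) := by
        rw [(hφ n).eq_neg_integral_ray θ hs]
        congr 1
        refine setIntegral_congr_fun measurableSet_Ioo fun t ht => ?_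
        have ht0 : 0 < t := hs.1.trans ht.1
        simp only [hd]
        rw [norm_smul, hθ1, mul_one, Real.norm_eq_abs, abs_of_pos ht0, smul_smul,
          inv_mul_cancel₀ ht0.ne', one_smul]
      have j1 : IntegrableOn (fun t : ℝ => F (t • (θ : Euc N))) (Ioo s R) :=
        integrableOn_tail hθ (by fun_prop) hs.1
      have j2 : IntegrableOn (fun t : ℝ => d (t • (θ : Euc N))) (Ioo s R) := by
        obtain ⟨C, hC⟩ := (hφ n).compact_gradient.exists_bound_of_continuous
          (hφ n).contDiff_gradient.continuous
        refine IntegrableOn.of_bound (C := C) (by simp) (by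
          exact Measurable.aestronglyMeasurable (by fun_prop)) (ae_of_all _ fun t => ?_)
        exact (abs_inner_unit_le _ _).trans (hC _)
      have e2 : v (s • (θ : Euc N)) + ∫ t in Ioo s R, F (t • (θ : Euc N))
          = (v (s • (θ : Euc N)) - φ n (s • (θ : Euc N))) +
            ∫ t in Ioo s R, (F (t • (θ : Euc N)) - d (t • (θ : Euc N))) := by
        rw [integral_sub j1 j2, e1]; ring
      simp only [hD]
      rw [e2]
      refine (enorm_add_le _ _).trans ?_
      gcongr
      exact enorm_integral_le_lintegral_enorm _
    refine (lintegral_mono_ae hray).trans ?_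
    have m1 : Measurable fun q : UnitSphere N × ℝ =>
      ‖v (q.2 • (q.1 : Euc N)) - φ n (q.2 • (q.1 : Euc N))‖ₑ := by fun_prop
    rw [lintegral_add_left (m1.lintegral_prod_right' (ν := rayMeasure N R)), i1,
      lintegral_const_mul' _ _ ENNReal.ofReal_ne_top]
    gcongr
  have hzero : ∫⁻ θ, ∫⁻ s, D (θ, s) ∂(rayMeasure N R) ∂(sphereMeasure N) = 0 := by
    have h := hφ1.add (ENNReal.Tendsto.const_mul (a := ENNReal.ofReal R) hφ2
      (Or.inr ENNReal.ofReal_ne_top))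
    rw [mul_zero, add_zero] at h
    exact le_antisymm (ge_of_tendsto' h hbound) zero_le
  rw [lintegral_eq_zero_iff (hDm.lintegral_prod_right' (ν := rayMeasure N R))] at hzero
  filter_upwards [hzero, ae_polar hN huv] with θ hθ huθ
  have hDθ : Measurable fun s => D (θ, s) := hDm.comp measurable_prodMk_left
  have h2 := (lintegral_eq_zero_iff hDθ).1 hθ
  filter_upwards [h2, huθ] with s hs hus
  rw [hus]
  have : v (s • (θ : Euc N)) + ∫ t in Ioo s R, F (t • (θ : Euc N)) = 0 := by
    simpa [hD] using hs
  linarith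

end Rays

/-! ### Rotations, and functions with radial gradient -/

section Rotation

variable {N : ℕ} {R : ℝ}

/-- The velocity of the rotation with angle `t` in the oriented plane spanned by `a, b`. -/
def rotVelocity (a b : Euc N) (t : ℝ) (x : Euc N) : Euc N :=
  (-(Real.sin t * inner ℝ a x) - Real.cos t * inner ℝ b x) • a +
    (Real.cos t * inner ℝ a x - Real.sin t * inner ℝ b x) • b

/-- The rotation with angle `t` in the oriented plane spanned by the orthonormal vectors `a, b`. -/
def rotFun (a b : Euc N) (t : ℝ) (x : Euc N) : Euc N :=
  x + ((Real.cos t - 1) * inner ℝ a x - Real.sin t * inner ℝ b x) • a +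
    (Real.sin t * inner ℝ a x + (Real.cos t - 1) * inner ℝ b x) • b

theorem inner_rotFun_self {a b : Euc N} (ha : ‖a‖ = 1) (hb : ‖b‖ = 1) (hab : inner ℝ a b = 0)
    (t : ℝ) (x : Euc N) : inner ℝ (rotFun a b t x) (rotFun a b t x) = inner ℝ x x := by
  have h1 : inner ℝ a a = 1 := by rw [real_inner_self_eq_norm_sq, ha]; norm_num
  have h2 : inner ℝ b b = 1 := by rw [real_inner_self_eq_norm_sq, hb]; norm_num
  have h3 : inner ℝ b a = 0 := by rw [real_inner_comm]; exact hab
  have h4 := Real.sin_sq_add_cos_sq t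
  simp only [rotFun, inner_add_left, inner_add_right, real_inner_smul_left, real_inner_smul_right,
    h1, h2, h3, hab, real_inner_comm a x, real_inner_comm b x]
  linear_combination (inner ℝ a x ^ 2 + inner ℝ b x ^ 2) * h4

theorem inner_rotFun_rotVelocity {a b : Euc N} (ha : ‖a‖ = 1) (hb : ‖b‖ = 1)
    (hab : inner ℝ a b = 0) (t : ℝ) (x : Euc N) :
    inner ℝ (rotFun a b t x) (rotVelocity a b t x) = 0 := by
  have h1 : inner ℝ a a = 1 := by rw [real_inner_self_eq_norm_sq, ha]; norm_num
  have h2 : inner ℝ b b = 1 := by rw [real_inner_self_eq_norm_sq, hb]; norm_num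
  have h3 : inner ℝ b a = 0 := by rw [real_inner_comm]; exact hab
  simp only [rotFun, rotVelocity, inner_add_left, inner_add_right, real_inner_smul_left,
    real_inner_smul_right, h1, h2, h3, hab, real_inner_comm a x, real_inner_comm b x]
  ring

theorem norm_rotVelocity_le {a b : Euc N} (ha : ‖a‖ = 1) (hb : ‖b‖ = 1) (t : ℝ) (x : Euc N) :
    ‖rotVelocity a b t x‖ ≤ 4 * ‖x‖ := by
  have h1 : |inner ℝ a x| ≤ ‖x‖ := by simpa [ha] using abs_real_inner_le_norm a x
  have h2 : |inner ℝ b x| ≤ ‖x‖ := by simpa [hb] using abs_real_inner_le_norm b x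
  have hmul : ∀ c y : ℝ, |c| ≤ 1 → |y| ≤ ‖x‖ → |c * y| ≤ ‖x‖ := by
    intro c y hc hy
    rw [abs_mul]
    exact (mul_le_of_le_one_left (abs_nonneg _) hc).trans hy
  have s1 := hmul _ _ (Real.abs_sin_le_one t) h1
  have s2 := hmul _ _ (Real.abs_sin_le_one t) h2
  have c1 := hmul _ _ (Real.abs_cos_le_one t) h1
  have c2 := hmul _ _ (Real.abs_cos_le_one t) h2
  unfold rotVelocity
  refine (norm_add_le _ _).trans ?_
  rw [norm_smul, norm_smul, ha, hb, mul_one, mul_one, Real.norm_eq_abs, Real.norm_eq_abs]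
  have e1 := abs_sub (-(Real.sin t * inner ℝ a x)) (Real.cos t * inner ℝ b x)
  have e2 := abs_sub (Real.cos t * inner ℝ a x) (Real.sin t * inner ℝ b x)
  rw [abs_neg] at e1
  linarith

theorem hasDerivAt_rotFun (a b : Euc N) (t : ℝ) (x : Euc N) :
    HasDerivAt (fun t => rotFun a b t x) (rotVelocity a b t x) t := by
  unfold rotFun rotVelocity
  have hs := Real.hasDerivAt_sin t
  have hc := Real.hasDerivAt_cos t
  have h1 := (((hc.sub_const 1).mul_const (inner ℝ a x)).sub
    (hs.mul_const (inner ℝ b x))).smul_const a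
  have h2 := ((hs.mul_const (inner ℝ a x)).add
    ((hc.sub_const 1).mul_const (inner ℝ b x))).smul_const b
  refine ((h1.const_add x).add h2).congr_deriv ?_
  congr 2 <;> ring

/-- The rotation as a linear isometric equivalence. -/
def rotation {a b : Euc N} (ha : ‖a‖ = 1) (hb : ‖b‖ = 1) (hab : inner ℝ a b = 0) (t : ℝ) :
    Euc N ≃ₗᵢ[ℝ] Euc N :=
  LinearIsometry.toLinearIsometryEquiv
    { toFun := rotFun a b t
      map_add' := fun x y => by
        simp only [rotFun, inner_add_right]
        module
      map_smul' := fun c x => by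
        simp only [rotFun, real_inner_smul_right, RingHom.id_apply]
        module
      norm_map' := fun x => by
        have h := inner_rotFun_self ha hb hab t x
        rw [real_inner_self_eq_norm_sq, real_inner_self_eq_norm_sq] at h
        exact (sq_eq_sq₀ (norm_nonneg _) (norm_nonneg _)).1 h } rfl

theorem rotation_apply {a b : Euc N} (ha : ‖a‖ = 1) (hb : ‖b‖ = 1) (hab : inner ℝ a b = 0) (t : ℝ)
    (x : Euc N) : rotation ha hb hab t x = rotFun a b t x := rfl

theorem exists_unit_orthogonal (hN : 2 ≤ N) {a : Euc N} (ha : a ≠ 0) :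
    ∃ b : Euc N, ‖b‖ = 1 ∧ inner ℝ a b = 0 := by
  have : Fact (Module.finrank ℝ (Euc N) = (N - 1) + 1) :=
    ⟨by rw [finrank_euclideanSpace_fin]; omega⟩
  have h : 0 < Module.finrank ℝ (ℝ ∙ a)ᗮ := by
    rw [Submodule.finrank_orthogonal_span_singleton (n := N - 1) ha]; omega
  have := Module.nontrivial_of_finrank_pos h
  obtain ⟨⟨b, hb⟩, hb0⟩ := exists_ne (0 : (ℝ ∙ a)ᗮ)
  have hb1 : b ≠ 0 := fun h => hb0 (Subtype.ext h)
  refine ⟨‖b‖⁻¹ • b, ?_, ?_⟩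
  · rw [norm_smul, norm_inv, norm_norm, inv_mul_cancel₀ (norm_ne_zero_iff.2 hb1)]
  · rw [real_inner_smul_right, Submodule.mem_orthogonal_singleton_iff_inner_right.1 hb, mul_zero]

/-- Rotate in the plane of x and y. If y is a multiple of x, any unit vector orthogonal to x
completes the plane, and here N ≥ 2 is needed. The angle is an arccosine, so it is nonnegative. -/
theorem exists_rotation (hN : 2 ≤ N) {x y : Euc N} (hx : x ≠ 0) (hxy : ‖y‖ = ‖x‖) :
    ∃ (a b : Euc N) (ha : ‖a‖ = 1) (hb : ‖b‖ = 1) (hab : inner ℝ a b = 0) (t : ℝ),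
      0 ≤ t ∧ rotation ha hb hab t x = y := by
  have hx0 : ‖x‖ ≠ 0 := norm_ne_zero_iff.2 hx
  set a := ‖x‖⁻¹ • x with ha_def
  have ha : ‖a‖ = 1 := by rw [ha_def, norm_smul, norm_inv, norm_norm, inv_mul_cancel₀ hx0]
  have haa : inner ℝ a a = 1 := by rw [real_inner_self_eq_norm_sq, ha]; norm_num
  have hxa : x = ‖x‖ • a := by rw [ha_def, smul_smul, mul_inv_cancel₀ hx0, one_smul]
  set z := y - inner ℝ a y • a with hz_def
  have hza : inner ℝ a z = 0 := by
    rw [hz_def, inner_sub_right, real_inner_smul_right, haa]; ring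
  obtain ⟨b, hb, hab, hzb⟩ : ∃ b : Euc N, ‖b‖ = 1 ∧ inner ℝ a b = 0 ∧ z = ‖z‖ • b := by
    by_cases hz : z = 0
    · obtain ⟨b, hb, hab⟩ := exists_unit_orthogonal hN (a := a) (by
        rintro h; rw [h, norm_zero] at ha; exact zero_ne_one ha)
      exact ⟨b, hb, hab, by rw [hz, norm_zero, zero_smul]⟩
    · have hz0 : ‖z‖ ≠ 0 := norm_ne_zero_iff.2 hz
      refine ⟨‖z‖⁻¹ • z, ?_, ?_, ?_⟩
      · rw [norm_smul, norm_inv, norm_norm, inv_mul_cancel₀ hz0]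
      · rw [real_inner_smul_right, hza, mul_zero]
      · rw [smul_smul, mul_inv_cancel₀ hz0, one_smul]
  have hyz : y = inner ℝ a y • a + ‖z‖ • b := by
    rw [← hzb, hz_def]; abel
  have hpyth : inner ℝ a y ^ 2 + ‖z‖ ^ 2 = ‖x‖ ^ 2 := by
    rw [← hxy, ← real_inner_self_eq_norm_sq z, ← real_inner_self_eq_norm_sq y, hz_def]
    simp only [inner_sub_left, inner_sub_right, real_inner_smul_left, real_inner_smul_right, haa,
      real_inner_comm a y]
    ring
  have hxpos : 0 < ‖x‖ := norm_pos_iff.2 hx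
  have hcs : (inner ℝ a y / ‖x‖) ^ 2 + (‖z‖ / ‖x‖) ^ 2 = 1 := by
    rw [div_pow, div_pow, ← add_div, hpyth, div_self (pow_ne_zero _ hx0)]
  -- By `hcs` the ratio lies in [-1,1], so `arccos` inverts the cosine.
  have hc := Real.cos_arccos (x := inner ℝ a y / ‖x‖)
    (by nlinarith [sq_nonneg (‖z‖ / ‖x‖)]) (by nlinarith [sq_nonneg (‖z‖ / ‖x‖)])
  have hs : Real.sin (Real.arccos (inner ℝ a y / ‖x‖)) = ‖z‖ / ‖x‖ := by
    rw [Real.sin_arccos, ← hcs, add_sub_cancel_left, Real.sqrt_sq (by positivity)]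
  refine ⟨a, b, ha, hb, hab, Real.arccos (inner ℝ a y / ‖x‖), Real.arccos_nonneg _, ?_⟩
  have h1 : inner ℝ a x = ‖x‖ := by
    conv_lhs => rw [hxa]
    rw [real_inner_smul_right, haa, mul_one]
  have h2 : inner ℝ b x = 0 := by
    conv_lhs => rw [hxa]
    rw [real_inner_smul_right, real_inner_comm, hab, mul_zero]
  rw [rotation_apply, rotFun, hc, hs, h1, h2]
  conv_rhs => rw [hyz]
  conv_lhs => rw [hxa]
  rw [norm_smul, norm_norm, ha, mul_one]
  have e1 : (inner ℝ a y / ‖x‖ - 1) * ‖x‖ - ‖z‖ / ‖x‖ * 0 = inner ℝ a y - ‖x‖ := by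
    field_simp; ring
  have e2 : ‖z‖ / ‖x‖ * ‖x‖ + (inner ℝ a y / ‖x‖ - 1) * 0 = ‖z‖ := by
    field_simp; ring
  rw [e1, e2]
  module

theorem measurePreserving_isometry_ball (Q : Euc N ≃ₗᵢ[ℝ] Euc N) :
    MeasurePreserving Q (volume.restrict (Metric.ball 0 R)) (volume.restrict (Metric.ball 0 R)) := by
  have h := Q.measurePreserving.restrict_preimage (measurableSet_ball (x := (0 : Euc N)) (ε := R))
  have h2 : Q ⁻¹' Metric.ball 0 R = Metric.ball 0 R := by
    ext x; simp
  rwa [h2] at h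

/-- Integrate ∇φ along the orbit of the rotation. The velocity is orthogonal to the position and ∇u
is radial, so ∇φ may be replaced by ∇φ - ∇u; the speed is at most 4R, and rotations preserve the
measure on the ball. -/
theorem lintegral_rotation_sub_le {u : Euc N → ℝ}
    (hgm : AEStronglyMeasurable (weakGrad (Metric.ball 0 R) u) (volume.restrict (Metric.ball 0 R)))
    (hrad : ∀ᵐ x ∂(volume.restrict (Metric.ball (0 : Euc N) R)),
      weakGrad (Metric.ball 0 R) u x = radialDeriv R u x • (‖x‖⁻¹ • x))
    {φ : Euc N → ℝ} (hφ : IsTestFunction (Metric.ball 0 R) φ)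
    {a b : Euc N} (ha : ‖a‖ = 1) (hb : ‖b‖ = 1) (hab : inner ℝ a b = 0) {t : ℝ} (ht : 0 ≤ t) :
    ∫⁻ x in Metric.ball 0 R, ‖φ (rotation ha hb hab t x) - φ x‖ₑ
      ≤ ENNReal.ofReal (4 * R) * ENNReal.ofReal t *
        eLpNorm (fun x => weakGrad (Metric.ball 0 R) u x - gradient φ x) 1
          (volume.restrict (Metric.ball 0 R)) := by
  set g := weakGrad (Metric.ball 0 R) u with hg
  have hgc := hφ.contDiff_gradient.continuous
  have hcont : Continuous fun q : Euc N × ℝ =>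
      inner ℝ (gradient φ (rotFun a b q.2 q.1)) (rotVelocity a b q.2 q.1) := by
    refine (hgc.comp ?_).inner ?_
    · unfold rotFun; fun_prop
    · unfold rotVelocity; fun_prop
  have hpt : ∀ x : Euc N, ‖φ (rotation ha hb hab t x) - φ x‖ₑ
      ≤ ∫⁻ s in Ioc 0 t, ‖inner ℝ (gradient φ (rotFun a b s x)) (rotVelocity a b s x)‖ₑ := by
    intro x
    have hd : ∀ s, HasDerivAt (fun s => φ (rotFun a b s x))
        (inner ℝ (gradient φ (rotFun a b s x)) (rotVelocity a b s x)) s := by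
      intro s
      rw [hφ.inner_gradient]
      have h2 := hasDerivAt_rotFun a b s x
      have h1 : HasFDerivAt φ (fderiv ℝ φ (rotFun a b s x)) (rotFun a b s x) :=
        ((hφ.smooth.differentiable (by simp)) _).hasFDerivAt
      exact h1.comp_hasDerivAt (f := fun s => rotFun a b s x) s h2
    have hc : Continuous fun s : ℝ =>
        inner ℝ (gradient φ (rotFun a b s x)) (rotVelocity a b s x) := by
      refine (hgc.comp ?_).inner ?_
      · unfold rotFun; fun_prop
      · unfold rotVelocity; fun_prop
    have h3 := intervalIntegral.integral_eq_sub_of_hasDerivAt (a := 0) (b := t)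
      (fun s _ => hd s) (hc.intervalIntegrable _ _)
    have h0 : rotFun a b 0 x = x := by simp [rotFun]
    rw [h0, intervalIntegral.integral_of_le ht] at h3
    rw [rotation_apply, ← h3]
    exact enorm_integral_le_lintegral_enorm _
  have hs : ∀ s : ℝ, ∫⁻ x in Metric.ball 0 R,
      ‖inner ℝ (gradient φ (rotFun a b s x)) (rotVelocity a b s x)‖ₑ
      ≤ ENNReal.ofReal (4 * R) * eLpNorm (fun x => g x - gradient φ x) 1
          (volume.restrict (Metric.ball 0 R)) := by
    intro s
    have hQ := measurePreserving_isometry_ball (R := R) (rotation ha hb hab s)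
    have hm : AEMeasurable (fun x => ‖g x - gradient φ x‖ₑ)
        (volume.restrict (Metric.ball 0 R)) := (hgm.sub hgc.aestronglyMeasurable).enorm
    have e1 : ∫⁻ x in Metric.ball 0 R, ‖g x - gradient φ x‖ₑ
        = ∫⁻ x in Metric.ball 0 R, ‖g (rotation ha hb hab s x)
          - gradient φ (rotation ha hb hab s x)‖ₑ := by
      conv_lhs => rw [← hQ.map_eq]
      refine lintegral_map' ?_ hQ.measurable.aemeasurable
      rwa [hQ.map_eq]
    rw [eLpNorm_one_eq_lintegral_enorm, e1, ← lintegral_const_mul' _ _ ENNReal.ofReal_ne_top]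
    refine lintegral_mono_ae ?_
    filter_upwards [hQ.quasiMeasurePreserving.ae hrad, ae_restrict_mem measurableSet_ball]
      with x hx hxB
    have hxR : ‖x‖ ≤ R := by simpa using (Metric.mem_ball.1 hxB).le
    have hR0 : 0 ≤ R := (norm_nonneg _).trans hxR
    -- At the rotated point the gradient of u is parallel to the position vector, hence orthogonal
    -- to the velocity.
    have h0 : inner ℝ (g (rotFun a b s x)) (rotVelocity a b s x) = 0 := by
      rw [← rotation_apply ha hb hab, hx, real_inner_smul_left, real_inner_smul_left,
        rotation_apply, inner_rotFun_rotVelocity ha hb hab, mul_zero, mul_zero]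
    have h1 : inner ℝ (gradient φ (rotFun a b s x)) (rotVelocity a b s x)
        = -inner ℝ (g (rotFun a b s x) - gradient φ (rotFun a b s x)) (rotVelocity a b s x) := by
      rw [inner_sub_left, h0]; ring
    rw [h1, enorm_neg, ← Real.enorm_of_nonneg (show 0 ≤ 4 * R by linarith), ← enorm_norm (g _ - _),
      ← enorm_mul, enorm_le_iff_norm_le, norm_mul, norm_norm, mul_comm]
    refine (norm_inner_le_norm _ _).trans ?_
    refine mul_le_mul_of_nonneg_left ?_ (norm_nonneg _)
    refine (norm_rotVelocity_le ha hb s x).trans ?_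
    rw [Real.norm_eq_abs]
    exact (by linarith : 4 * ‖x‖ ≤ 4 * R).trans (le_abs_self _)
  calc ∫⁻ x in Metric.ball 0 R, ‖φ (rotation ha hb hab t x) - φ x‖ₑ
      ≤ ∫⁻ x in Metric.ball 0 R, ∫⁻ s in Ioc 0 t,
          ‖inner ℝ (gradient φ (rotFun a b s x)) (rotVelocity a b s x)‖ₑ := lintegral_mono hpt
    _ = ∫⁻ s in Ioc 0 t, ∫⁻ x in Metric.ball 0 R,
          ‖inner ℝ (gradient φ (rotFun a b s x)) (rotVelocity a b s x)‖ₑ :=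
        lintegral_lintegral_swap hcont.enorm.measurable.aemeasurable
    _ ≤ ∫⁻ s in Ioc 0 t, ENNReal.ofReal (4 * R) * eLpNorm (fun x => g x - gradient φ x) 1
          (volume.restrict (Metric.ball 0 R)) := lintegral_mono hs
    _ = _ := by
        rw [lintegral_const, Measure.restrict_apply .univ, univ_inter, Real.volume_Ioc, sub_zero]
        ring

/-- Compare u∘Q and u through φ n∘Q and φ n; all three errors tend to 0 in L^1. -/
theorem ae_eq_comp_rotation {p : ℝ} (hp : 1 ≤ p) {u : Euc N → ℝ}
    (hu : u ∈ W01p p (Metric.ball 0 R))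
    (hrad : ∀ᵐ x ∂(volume.restrict (Metric.ball (0 : Euc N) R)),
      weakGrad (Metric.ball 0 R) u x = radialDeriv R u x • (‖x‖⁻¹ • x))
    {a b : Euc N} (ha : ‖a‖ = 1) (hb : ‖b‖ = 1) (hab : inner ℝ a b = 0) {t : ℝ} (ht : 0 ≤ t) :
    ∀ᵐ x ∂(volume.restrict (Metric.ball (0 : Euc N) R)), u (rotation ha hb hab t x) = u x := by
  have hfin : volume (Metric.ball (0 : Euc N) R) ≠ ⊤ := measure_ball_lt_top.ne
  obtain ⟨φ, hφ, hφ1, hφ2⟩ := exists_seq_of_mem_W01p hfin hp hu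
  set Q := rotation ha hb hab t with hQdef
  have hQ := measurePreserving_isometry_ball (R := R) Q
  have hum := hu.1.1.1
  have huQ : AEStronglyMeasurable (fun x => u (Q x)) (volume.restrict (Metric.ball 0 R)) :=
    hum.comp_measurePreserving hQ
  have hbound : ∀ n, ∫⁻ x in Metric.ball 0 R, ‖u (Q x) - u x‖ₑ ≤
      eLpNorm (fun x => u x - φ n x) 1 (volume.restrict (Metric.ball 0 R)) +
      (ENNReal.ofReal (4 * R) * ENNReal.ofReal t *
        eLpNorm (fun x => weakGrad (Metric.ball 0 R) u x - gradient (φ n) x) 1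
          (volume.restrict (Metric.ball 0 R)) +
      eLpNorm (fun x => u x - φ n x) 1 (volume.restrict (Metric.ball 0 R))) := by
    intro n
    have hφm : AEStronglyMeasurable (φ n) (volume.restrict (Metric.ball 0 R)) :=
      (hφ n).smooth.continuous.aestronglyMeasurable
    have hφQ : AEStronglyMeasurable (fun x => φ n (Q x)) (volume.restrict (Metric.ball 0 R)) :=
      hφm.comp_measurePreserving hQ
    have e1 : eLpNorm (fun x => u x - φ n x) 1 (volume.restrict (Metric.ball 0 R))
        = ∫⁻ x in Metric.ball 0 R, ‖u (Q x) - φ n (Q x)‖ₑ := by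
      rw [← eLpNorm_comp_measurePreserving (g := fun x => u x - φ n x) (hum.sub hφm) hQ,
        eLpNorm_one_eq_lintegral_enorm]
      rfl
    have h2 := lintegral_rotation_sub_le hu.1.2.2.1 hrad (hφ n) ha hb hab ht
    have m1 : AEStronglyMeasurable (fun x => φ n (Q x) - φ n x)
      (volume.restrict (Metric.ball 0 R)) := hφQ.sub hφm
    have m2 : AEStronglyMeasurable (fun x => u (Q x) - φ n (Q x))
      (volume.restrict (Metric.ball 0 R)) := huQ.sub hφQ
    refine le_trans ?_ (add_le_add e1.ge (add_le_add_left h2 _))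
    rw [eLpNorm_one_eq_lintegral_enorm, ← lintegral_add_left' m1.enorm,
      ← lintegral_add_left' m2.enorm]
    refine lintegral_mono fun x => ?_
    have : u (Q x) - u x = (u (Q x) - φ n (Q x)) + ((φ n (Q x) - φ n x) + -(u x - φ n x)) := by
      ring
    rw [this]
    refine (enorm_add_le _ _).trans ?_
    gcongr
    refine (enorm_add_le _ _).trans ?_
    rw [enorm_neg]
  have hzero : ∫⁻ x in Metric.ball 0 R, ‖u (Q x) - u x‖ₑ = 0 := by
    have h := hφ1.add ((ENNReal.Tendsto.const_mul
      (a := ENNReal.ofReal (4 * R) * ENNReal.ofReal t) hφ2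
      (Or.inr (ENNReal.mul_ne_top ENNReal.ofReal_ne_top ENNReal.ofReal_ne_top))).add hφ1)
    rw [mul_zero, add_zero, add_zero] at h
    exact le_antisymm (ge_of_tendsto' h hbound) zero_le
  have m : AEStronglyMeasurable (fun x => u (Q x) - u x)
    (volume.restrict (Metric.ball 0 R)) := huQ.sub hum
  rw [lintegral_eq_zero_iff' m.enorm] at hzero
  filter_upwards [hzero] with x hx
  exact sub_eq_zero.1 (by simpa using hx)

/-- A function in `W_0^{1,p}(B_R)` whose gradient is radial is radially symmetric. -/
theorem isRadial_of_weakGrad_radial (hN : 2 ≤ N) {p : ℝ} (hp : 1 ≤ p) {u : Euc N → ℝ}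
    (hu : u ∈ W01p p (Metric.ball 0 R))
    (hrad : ∀ᵐ x ∂(volume.restrict (Metric.ball (0 : Euc N) R)),
      weakGrad (Metric.ball 0 R) u x = radialDeriv R u x • (‖x‖⁻¹ • x)) :
    IsRadial R u := by
  have hp' : 1 ≤ ENNReal.ofReal p := by simpa using ENNReal.ofReal_le_ofReal hp
  have : IsFiniteMeasure ((volume : Measure (Euc N)).restrict (Metric.ball 0 R)) :=
    ⟨by simpa using measure_ball_lt_top⟩
  -- Invariance under each rotation holds off a null set depending on the rotation. Lebesgue points
  -- remove this dependence: ball averages of U do not see null sets. Extending by 0 makes U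
  -- integrable on the whole space.
  set U := (Metric.ball (0 : Euc N) R).indicator u with hU
  have hUi : Integrable U volume :=
    (integrable_indicator_iff measurableSet_ball).2 (hu.1.1.integrable hp')
  set A : Euc N → ℝ → ℝ := fun x r => ⨍ y in Metric.closedBall x r, U y with hA
  set S : Set (Euc N) := {x | Tendsto (A x) (𝓝[>] 0) (𝓝 (U x))} with hS
  have hSae : ∀ᵐ x ∂(volume : Measure (Euc N)), x ∈ S := by
    filter_upwards [IsUnifLocDoublingMeasure.ae_tendsto_average (μ := volume)
      hUi.locallyIntegrable 1] with x hx
    refine hx (fun _ => x) id tendsto_id ?_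
    filter_upwards [self_mem_nhdsWithin] with r hr
    exact Metric.mem_closedBall_self (by simpa using (mem_Ioi.1 hr).le)
  have hkey : ∀ x ∈ S, ∀ y ∈ S, ‖y‖ = ‖x‖ → U x = U y := by
    intro x hx y hy hxy
    by_cases hx0 : x = 0
    · rw [hx0, norm_zero, norm_eq_zero] at hxy
      rw [hx0, hxy]
    obtain ⟨a, b, ha, hb, hab, t, ht, hQ⟩ := exists_rotation hN hx0 hxy
    set Q := rotation ha hb hab t with hQd
    have hUQ : ∀ᵐ z ∂(volume : Measure (Euc N)), U (Q z) = U z := by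
      have h := (ae_restrict_iff' measurableSet_ball).1
        (ae_eq_comp_rotation hp hu hrad ha hb hab ht)
      filter_upwards [h] with z hz
      have hmem : Q z ∈ Metric.ball (0 : Euc N) R ↔ z ∈ Metric.ball (0 : Euc N) R := by simp
      by_cases hzB : z ∈ Metric.ball (0 : Euc N) R
      · rw [hU, indicator_of_mem hzB, indicator_of_mem (hmem.2 hzB)]
        exact hz hzB
      · rw [hU, indicator_of_notMem hzB, indicator_of_notMem fun h' => hzB (hmem.1 h')]
    -- Q maps balls around x onto balls around y, preserves the measure, and leaves U unchanged a.e.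
    have hAxy : A y = A x := by
      ext r
      have hpre : Q ⁻¹' Metric.closedBall y r = Metric.closedBall x r := by
        ext z
        rw [mem_preimage, Metric.mem_closedBall, Metric.mem_closedBall, ← hQ, Q.dist_map]
      have h1 := Q.measurePreserving.setIntegral_preimage_emb
        Q.toHomeomorph.measurableEmbedding U (Metric.closedBall y r)
      have h2 := Q.measurePreserving.measure_preimage
        (measurableSet_closedBall (x := y) (ε := r)).nullMeasurableSet
      rw [hpre] at h1 h2
      simp only [hA, setAverage_eq, measureReal_def]
      rw [← h1, h2]
      congr 1
      exact integral_congr_ae (ae_restrict_of_ae hUQ)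
    have h1 : Tendsto (A y) (𝓝[>] 0) (𝓝 (U x)) := hAxy ▸ hx
    exact tendsto_nhds_unique h1 hy
  classical
  -- The profile need not be measurable, so its value at r may be read off at any point of S of norm
  -- r.
  refine ⟨fun r => if h : ∃ y ∈ S, ‖y‖ = r then U h.choose else 0, ?_⟩
  filter_upwards [ae_restrict_of_ae hSae, ae_restrict_mem measurableSet_ball] with x hx hxB
  have hex : ∃ y ∈ S, ‖y‖ = ‖x‖ := ⟨x, hx, rfl⟩
  rw [dif_pos hex, ← hkey x hx _ hex.choose_spec.1 hex.choose_spec.2, hU, indicator_of_mem hxB]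

end Rotation

/-! ### The extended integral -/

section ExtIntegral

variable {N : ℕ} {Ω : Set (Euc N)} {f g : Euc N → ℝ}

theorem extIntegral_mono (h : f ≤ᵐ[volume.restrict Ω] g) : extIntegral Ω f ≤ extIntegral Ω g := by
  refine EReal.sub_le_sub ?_ ?_
  · refine EReal.coe_ennreal_le_coe_ennreal_iff.2 (lintegral_mono_ae ?_)
    filter_upwards [h] with x hx
    exact ENNReal.ofReal_le_ofReal hx
  · refine EReal.coe_ennreal_le_coe_ennreal_iff.2 (lintegral_mono_ae ?_)
    filter_upwards [h] with x hx
    exact ENNReal.ofReal_le_ofReal (neg_le_neg hx)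

theorem extIntegral_congr (h : f =ᵐ[volume.restrict Ω] g) : extIntegral Ω f = extIntegral Ω g :=
  le_antisymm (extIntegral_mono h.le) (extIntegral_mono h.symm.le)

theorem extIntegral_eq_integral (hf : Integrable f (volume.restrict Ω)) :
    extIntegral Ω f = ((∫ x in Ω, f x : ℝ) : EReal) := by
  have hneg : ∫⁻ x in Ω, ENNReal.ofReal (-f x) ≠ ⊤ := hf.neg.lintegral_lt_top.ne
  rw [integral_eq_lintegral_pos_part_sub_lintegral_neg_part hf, EReal.coe_sub,
    EReal.coe_ennreal_toReal hf.lintegral_lt_top.ne, EReal.coe_ennreal_toReal hneg]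
  rfl

/-- The lower bound makes the negative part integrable; were the positive part not, the difference
would be +∞. -/
theorem integrable_of_extIntegral_lt_top {l : Euc N → ℝ}
    (hf : AEStronglyMeasurable f (volume.restrict Ω)) (hl : Integrable l (volume.restrict Ω))
    (hle : l ≤ᵐ[volume.restrict Ω] f) (h : extIntegral Ω f < ⊤) :
    Integrable f (volume.restrict Ω) := by
  have hneg : ∫⁻ x in Ω, ENNReal.ofReal (-f x) < ⊤ := by
    refine lt_of_le_of_lt (lintegral_mono_ae ?_) hl.neg.lintegral_lt_top
    filter_upwards [hle] with x hx
    exact ENNReal.ofReal_le_ofReal (neg_le_neg hx)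
  have hpos : ∫⁻ x in Ω, ENNReal.ofReal (f x) < ⊤ := by
    by_contra hcon
    have htop : ∫⁻ x in Ω, ENNReal.ofReal (f x) = ⊤ := not_lt_top_iff.1 hcon
    unfold extIntegral at h
    rw [htop, ← EReal.coe_ennreal_toReal hneg.ne, EReal.coe_ennreal_top, EReal.top_sub_coe] at h
    exact lt_irrefl _ h
  refine ⟨hf, ?_⟩
  rw [HasFiniteIntegral]
  calc ∫⁻ x in Ω, ‖f x‖ₑ ≤ ∫⁻ x in Ω, (ENNReal.ofReal (f x) + ENNReal.ofReal (-f x)) := by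
        refine lintegral_mono fun x => ?_
        rcases le_total 0 (f x) with h0 | h0
        · rw [Real.enorm_of_nonneg h0]; exact le_self_add
        · rw [← enorm_neg, Real.enorm_of_nonneg (neg_nonneg.2 h0)]; exact le_add_self
    _ = _ := lintegral_add_left' hf.aemeasurable.ennreal_ofReal _
    _ < ⊤ := ENNReal.add_lt_top.2 ⟨hpos, hneg⟩

end ExtIntegral

/-! ### Energy of radial functions and of rays of a minimizer -/

section Energy

variable {N : ℕ} {R p : ℝ} {W : Euc N → ℝ} {Wt G : ℝ → ℝ}

/-- The energy density of the radial function with profile `r ↦ -∫_r^R F`. -/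
def profileDensity (R : ℝ) (Wt G : ℝ → ℝ) (F : ℝ → ℝ) (s : ℝ) : ℝ :=
  Wt (F s) + G (-∫ t in Ioo s R, F t)

theorem even_apply_abs (hWt : Function.Even Wt) (t : ℝ) : Wt |t| = Wt t := by
  rcases abs_cases t with ⟨h, _⟩ | ⟨h, _⟩ <;> rw [h]
  exact hWt t

/-- Since 0 ≤ p - ρ ≤ p, the lower growth of `G` is absorbed by 1 + |v|^p. The bound is uniform in
ξ, so it serves both for the full gradient and for its radial part. -/
theorem exists_integrable_lower_bound (hp : 1 ≤ p) (hW : Coercive p W) (hG : Growth N p G)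
    {v : Euc N → ℝ}
    (hv : MemLp v (ENNReal.ofReal p) (volume.restrict (Metric.ball 0 R))) :
    ∃ l : Euc N → ℝ, Integrable l (volume.restrict (Metric.ball 0 R)) ∧
      ∀ x ξ, l x ≤ W ξ + G (v x) := by
  have hp0 : 0 < p := by linarith
  have : IsFiniteMeasure ((volume : Measure (Euc N)).restrict (Metric.ball 0 R)) :=
    ⟨by simpa using measure_ball_lt_top⟩
  obtain ⟨ν₁, C₁, hν₁, -, hW⟩ := hW
  obtain ⟨C, ν₃, ν₄, ρ, -, hν₃, -, hρ, hρp, hG, -⟩ := hG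
  refine ⟨fun x => -ν₃ * (1 + ‖v x‖ ^ p) - C - C₁, ?_, fun x ξ => ?_⟩
  · have h := hv.integrable_norm_rpow (by simpa using hp0) ENNReal.ofReal_ne_top
    rw [ENNReal.toReal_ofReal hp0.le] at h
    exact ((((integrable_const 1).add h).const_mul (-ν₃)).sub (integrable_const C)).sub
      (integrable_const C₁)
  · have h1 := hW ξ
    have h2 := hG (v x)
    have h3 : 0 ≤ ν₁ * ‖ξ‖ ^ p := by positivity
    have h4 : |v x| ^ (p - ρ) ≤ 1 + ‖v x‖ ^ p := by
      rw [Real.norm_eq_abs]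
      rcases le_total |v x| 1 with h | h
      · have := Real.rpow_le_one (abs_nonneg (v x)) h (sub_nonneg.2 hρp)
        have : 0 ≤ |v x| ^ p := by positivity
        linarith
      · have := Real.rpow_le_rpow_of_exponent_le h (by linarith : p - ρ ≤ p)
        linarith
    have h5 := mul_le_mul_of_nonneg_left h4 hν₃
    simp only
    linarith

theorem IsMinimizer.congr (hp : 1 ≤ p) {u v : Euc N → ℝ} (hu : IsMinimizer p R W G u)
    (h : u =ᵐ[volume.restrict (Metric.ball 0 R)] v) : IsMinimizer p R W G v := by
  obtain ⟨h1, h2⟩ := W01p_congr Metric.isOpen_ball measure_ball_lt_top.ne hp hu.1 h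
  refine ⟨h1, fun w hw => ?_⟩
  refine le_of_eq_of_le ?_ (hu.2 w hw)
  refine extIntegral_congr ?_
  filter_upwards [h, h2] with x hx hx2
  rw [hx, hx2]

theorem aestronglyMeasurable_density (hW0 : Continuous W) (hG0 : Continuous G)
    {v : Euc N → ℝ} (hv : v ∈ W01p p (Metric.ball 0 R)) :
    AEStronglyMeasurable (fun x => W (weakGrad (Metric.ball 0 R) v x) + G (v x))
      (volume.restrict (Metric.ball 0 R)) :=
  (hW0.comp_aestronglyMeasurable hv.1.2.2.1).add (hG0.comp_aestronglyMeasurable hv.1.1.1)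

theorem ae_ne_zero_ball (hN : 1 ≤ N) :
    ∀ᵐ x ∂(volume.restrict (Metric.ball (0 : Euc N) R)), ‖x‖ ∈ Ioo 0 R :=
  ae_norm hN ae_mem_rayMeasure

theorem norm_unit {x : Euc N} (hx : 0 < ‖x‖) : ‖‖x‖⁻¹ • x‖ = 1 := by
  rw [norm_smul, norm_inv, norm_norm, inv_mul_cancel₀ hx.ne']

theorem density_radialPrim (hN : 1 ≤ N) (hR : 0 < R) (hp : 1 ≤ p)
    (hWt_even : Function.Even Wt) (hWsym : ∀ ξ, W ξ = Wt ‖ξ‖)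
    {F : ℝ → ℝ} (hFm : Measurable F) (hF : MemLp F (ENNReal.ofReal p) (rayMeasure N R)) :
    ∀ᵐ x ∂(volume.restrict (Metric.ball (0 : Euc N) R)),
      W (weakGrad (Metric.ball 0 R) (radialPrim N R F) x) + G (radialPrim N R F x)
        = profileDensity R Wt G F ‖x‖ := by
  filter_upwards [(radialPrim_mem_W01p hN hR hp hFm hF).2, ae_ne_zero_ball hN] with x hx hx0
  rw [hx, hWsym, norm_smul, norm_unit hx0.1, mul_one, Real.norm_eq_abs, even_apply_abs hWt_even]
  rfl

theorem radialDeriv_radialPrim (hN : 1 ≤ N) (hR : 0 < R) (hp : 1 ≤ p)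
    {F : ℝ → ℝ} (hFm : Measurable F) (hF : MemLp F (ENNReal.ofReal p) (rayMeasure N R)) :
    ∀ᵐ x ∂(volume.restrict (Metric.ball (0 : Euc N) R)),
      radialDeriv R (radialPrim N R F) x = F ‖x‖ := by
  filter_upwards [(radialPrim_mem_W01p hN hR hp hFm hF).2, ae_ne_zero_ball hN] with x hx hx0
  rw [radialDeriv, hx, real_inner_smul_left, real_inner_self_eq_norm_sq, norm_unit hx0.1]
  ring

theorem energy_radialPrim (hN : 1 ≤ N) (hR : 0 < R) (hp : 1 ≤ p)
    (hWt_even : Function.Even Wt) (hWsym : ∀ ξ, W ξ = Wt ‖ξ‖)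
    {F : ℝ → ℝ} (hFm : Measurable F) (hF : MemLp F (ENNReal.ofReal p) (rayMeasure N R))
    (hint : Integrable (profileDensity R Wt G F) (rayMeasure N R)) :
    energy R W G (radialPrim N R F)
      = (((sphereArea N).toReal * ∫ s, profileDensity R Wt G F s ∂(rayMeasure N R) : ℝ) : EReal) := by
  have hA : sphereArea N ≠ ⊤ := measure_ne_top _ _
  have hmp := measurePreserving_norm (N := N) (R := R) hN
  have h1 : Integrable (profileDensity R Wt G F) (sphereArea N • rayMeasure N R) :=
    hint.smul_measure hA
  have h2 : Integrable (fun x : Euc N => profileDensity R Wt G F ‖x‖)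
      (volume.restrict (Metric.ball 0 R)) := (hmp.integrable_comp h1.1).2 h1
  rw [energy, extIntegral_congr (density_radialPrim hN hR hp hWt_even hWsym hFm hF),
    extIntegral_eq_integral h2]
  congr 1
  rw [← integral_map (φ := fun x : Euc N => ‖x‖) (f := profileDensity R Wt G F)
    hmp.measurable.aemeasurable (by rw [hmp.map_eq]; exact h1.1), hmp.map_eq,
    integral_smul_measure, smul_eq_mul]

/-- The zero function is a competitor with constant density on a set of finite measure. -/
theorem IsMinimizer.energy_lt_top (hN : 1 ≤ N) (hR : 0 < R) (hp : 1 ≤ p) {u : Euc N → ℝ}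
    (hu : IsMinimizer p R W G u) : energy R W G u < ⊤ := by
  have : IsFiniteMeasure ((volume : Measure (Euc N)).restrict (Metric.ball 0 R)) :=
    ⟨by simpa using measure_ball_lt_top⟩
  obtain ⟨h1, h2⟩ := radialPrim_mem_W01p (N := N) (p := p) (F := fun _ => 0) hN hR hp
    measurable_const MemLp.zero'
  refine (hu.2 _ h1).trans_lt ?_
  have h3 : energy R W G (radialPrim N R fun _ => 0)
      = extIntegral (Metric.ball (0 : Euc N) R) fun _ => W 0 + G 0 := by
    refine extIntegral_congr ?_
    filter_upwards [h2] with x hx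
    rw [hx]
    simp [radialPrim]
  rw [h3, extIntegral_eq_integral (integrable_const _)]
  exact EReal.coe_lt_top _

theorem IsMinimizer.integrable_density (hN : 1 ≤ N) (hR : 0 < R) (hp : 1 ≤ p)
    (hW0 : Continuous W) (hW1 : Coercive p W) (hG0 : Continuous G) (hG1 : Growth N p G)
    {u : Euc N → ℝ} (hu : IsMinimizer p R W G u) :
    Integrable (fun x => W (weakGrad (Metric.ball 0 R) u x) + G (u x))
      (volume.restrict (Metric.ball 0 R)) := by
  obtain ⟨l, hl, hle⟩ := exists_integrable_lower_bound hp hW1 hG1 hu.1.1.1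
  exact integrable_of_extIntegral_lt_top (aestronglyMeasurable_density hW0 hG0 hu.1) hl
    (ae_of_all _ fun x => hle x _) (hu.energy_lt_top hN hR hp)

/-- Along almost every ray, the restriction of a minimizer is the profile of a radially symmetric
minimizer, and only the radial derivative contributes to the energy. -/
theorem IsMinimizer.ae_ray (hN : 1 ≤ N) (hR : 0 < R) (hp : 1 ≤ p)
    (hW0 : Continuous W) (hW1 : Coercive p W) (hWt : Continuous Wt)
    (hWt_even : Function.Even Wt) (hWsym : ∀ ξ, W ξ = Wt ‖ξ‖)
    (hG0 : Continuous G) (hG1 : Growth N p G) (hWt_mono : MonotoneOn Wt (Ici 0))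
    {u F : Euc N → ℝ} (hu : IsMinimizer p R W G u) (hFm : Measurable F)
    (hF : radialDeriv R u =ᵐ[volume.restrict (Metric.ball 0 R)] F) :
    (∀ᵐ x ∂(volume.restrict (Metric.ball (0 : Euc N) R)),
      W (weakGrad (Metric.ball 0 R) u x) = Wt (F x)) ∧
    ∀ᵐ θ : UnitSphere N ∂(sphereMeasure N),
      MemLp (fun s : ℝ => F (s • (θ : Euc N))) (ENNReal.ofReal p) (rayMeasure N R) ∧
      (∀ᵐ s ∂(rayMeasure N R), u (s • (θ : Euc N)) = -∫ t in Ioo s R, F (t • (θ : Euc N))) ∧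
      IsMinimizer p R W G (radialPrim N R fun s => F (s • (θ : Euc N))) := by
  have hFle : ∀ᵐ x ∂(volume.restrict (Metric.ball (0 : Euc N) R)),
      |F x| ≤ ‖weakGrad (Metric.ball 0 R) u x‖ := by
    filter_upwards [hF] with x hx
    rw [← hx]
    exact abs_inner_unit_le _ _
  have hFp : MemLp F (ENNReal.ofReal p) (volume.restrict (Metric.ball 0 R)) :=
    hu.1.1.2.2.mono hFm.aestronglyMeasurable hFle
  have hWF : ∀ᵐ x ∂(volume.restrict (Metric.ball (0 : Euc N) R)),
      Wt (F x) ≤ W (weakGrad (Metric.ball 0 R) u x) := by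
    filter_upwards [hFle] with x hx
    rw [hWsym, ← even_apply_abs hWt_even]
    exact hWt_mono (mem_Ici.2 (abs_nonneg _)) (mem_Ici.2 (norm_nonneg _)) hx
  obtain ⟨l, hl, hle⟩ := exists_integrable_lower_bound hp hW1 hG1 hu.1.1.1
  have hdi := hu.integrable_density hN hR hp hW0 hW1 hG0 hG1
  -- The density with only the radial derivative kept; it lies between two integrable functions.
  set k : Euc N → ℝ := fun x => Wt (F x) + G (u x) with hk
  have hkm : AEStronglyMeasurable k (volume.restrict (Metric.ball 0 R)) :=
    (hWt.comp_aestronglyMeasurable hFm.aestronglyMeasurable).add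
      (hG0.comp_aestronglyMeasurable hu.1.1.1.1)
  have hkle : k ≤ᵐ[volume.restrict (Metric.ball 0 R)]
      fun x => W (weakGrad (Metric.ball 0 R) u x) + G (u x) := by
    filter_upwards [hWF] with x hx
    simp only [hk]
    linarith
  have hlk : ∀ x, l x ≤ k x := by
    intro x
    -- Any vector of length |F x| turns W into `Wt` at F x.
    have h := hle x (F x • EuclideanSpace.single (⟨0, hN⟩ : Fin N) (1 : ℝ))
    rw [hWsym, norm_smul] at h
    simpa [even_apply_abs hWt_even] using h
  have hki : Integrable k (volume.restrict (Metric.ball 0 R)) :=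
    integrable_of_le_of_le hkm (ae_of_all _ hlk) hkle hl hdi
  set m := ∫ x in Metric.ball 0 R, (W (weakGrad (Metric.ball 0 R) u x) + G (u x)) with hm
  have hEm : energy R W G u = (m : EReal) := extIntegral_eq_integral hdi
  have hpol := measurePreserving_polar (N := N) (R := R) hN
  have hkprod : Integrable (fun q : UnitSphere N × ℝ => k (q.2 • (q.1 : Euc N)))
      ((sphereMeasure N).prod (rayMeasure N R)) := (hpol.integrable_comp hkm).2 hki
  set e : UnitSphere N → ℝ := fun θ => ∫ s, k (s • (θ : Euc N)) ∂(rayMeasure N R) with he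
  have hke : ∫ x in Metric.ball 0 R, k x = ∫ θ, e θ ∂(sphereMeasure N) := by
    rw [← hpol.map_eq, integral_map hpol.measurable.aemeasurable (by rwa [hpol.map_eq]),
      integral_prod _ hkprod]
  set A := (sphereArea N).toReal with hA
  have hApos : 0 < A := ENNReal.toReal_pos (sphereArea_ne_zero hN) (measure_ne_top _ _)
  have hray : ∀ᵐ θ : UnitSphere N ∂(sphereMeasure N),
      MemLp (fun s : ℝ => F (s • (θ : Euc N))) (ENNReal.ofReal p) (rayMeasure N R) ∧
      (∀ᵐ s ∂(rayMeasure N R), u (s • (θ : Euc N)) = -∫ t in Ioo s R, F (t • (θ : Euc N))) ∧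
      energy R W G (radialPrim N R fun s => F (s • (θ : Euc N))) = ((A * e θ : ℝ) : EReal) := by
    filter_upwards [ae_memLp_ray hN hp hFm hFp, ae_eq_neg_integral_ray hN hp hu.1 hFm hF,
      hkprod.prod_right_ae] with θ h1 h2 h3
    refine ⟨h1, h2, ?_⟩
    have h4 : (fun s => k (s • (θ : Euc N))) =ᵐ[rayMeasure N R]
        profileDensity R Wt G fun s => F (s • (θ : Euc N)) := by
      filter_upwards [h2] with s hs
      simp only [hk, profileDensity]
      rw [hs]
    rw [energy_radialPrim hN hR hp hWt_even hWsym (by fun_prop) h1 (h3.congr h4),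
      ← integral_congr_ae h4]
  -- Each ray profile is a competitor, so A e(θ) is at least the minimum m.
  have hmin : ∀ᵐ θ : UnitSphere N ∂(sphereMeasure N), 0 ≤ A * e θ - m := by
    filter_upwards [hray] with θ ⟨h1, h2, h3⟩
    have h4 := hu.2 _ (radialPrim_mem_W01p hN hR hp (by fun_prop) h1).1
    rw [h3, hEm, EReal.coe_le_coe_iff] at h4
    linarith
  have hei : Integrable e (sphereMeasure N) := hkprod.integral_prod_left
  have hint : Integrable (fun θ => A * e θ - m) (sphereMeasure N) :=
    (hei.const_mul A).sub (integrable_const m)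
  have hval : ∫ θ, (A * e θ - m) ∂(sphereMeasure N)
      = A * ((∫ x in Metric.ball 0 R, k x) - m) := by
    rw [integral_sub (hei.const_mul A) (integrable_const m), integral_const_mul, integral_const,
      hke, smul_eq_mul, measureReal_def]
    ring
  have hkm' : ∫ x in Metric.ball 0 R, k x ≤ m := integral_mono_ae hki hdi hkle
  have hge := integral_nonneg_of_ae hmin
  rw [hval] at hge
  -- The nonnegative function A e - m has integral A (∫k - m) ≤ 0, so ∫k = m. Equality then
  -- propagates twice: to the densities on the ball and to almost every direction.
  have hkeq : ∫ x in Metric.ball 0 R, k x = m := by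
    have := nonneg_of_mul_nonneg_right hge hApos
    linarith
  constructor
  · have h0 : ∫ x in Metric.ball 0 R,
        (W (weakGrad (Metric.ball 0 R) u x) + G (u x) - k x) = 0 := by
      rw [integral_sub hdi hki, hkeq, hm, sub_self]
    rw [integral_eq_zero_iff_of_nonneg_ae (hkle.mono fun x hx => sub_nonneg.2 hx)
      (hdi.sub hki)] at h0
    filter_upwards [h0] with x hx
    simp only [hk, Pi.zero_apply] at hx
    linarith
  · have h0 : ∫ θ, (A * e θ - m) ∂(sphereMeasure N) = 0 := by rw [hval, hkeq]; ring
    rw [integral_eq_zero_iff_of_nonneg_ae hmin hint] at h0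
    filter_upwards [hray, h0] with θ ⟨h1, h2, h3⟩ h4
    refine ⟨h1, h2, (radialPrim_mem_W01p hN hR hp (by fun_prop) h1).1, fun v hv => ?_⟩
    have h5 : A * e θ = m := sub_eq_zero.1 h4
    rw [h3, h5, ← hEm]
    exact hu.2 v hv

end Energy

/-! ### Lifting the derivative along plateaus of `Wt` -/

section Plateau

variable {N : ℕ} {R p : ℝ} {W : Euc N → ℝ} {Wt G : ℝ → ℝ}

open Classical in
/-- Enlarges `|t|` to `c` if `|t| < c` and `Wt` takes the same value at `t` and `c`. -/
def plateauLift (Wt : ℝ → ℝ) (c t : ℝ) : ℝ := if |t| < c ∧ Wt t = Wt c then c else |t|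

theorem abs_le_plateauLift (c t : ℝ) : |t| ≤ plateauLift Wt c t := by
  unfold plateauLift
  split_ifs with h
  · exact h.1.le
  · exact le_rfl

theorem plateauLift_nonneg (c t : ℝ) : 0 ≤ plateauLift Wt c t :=
  (abs_nonneg t).trans (abs_le_plateauLift c t)

theorem plateauLift_le (c t : ℝ) : plateauLift Wt c t ≤ |t| + |c| := by
  unfold plateauLift
  split_ifs with h
  · linarith [le_abs_self c, abs_nonneg t]
  · linarith [abs_nonneg c]

theorem apply_plateauLift (hWt : Function.Even Wt) (c t : ℝ) :
    Wt (plateauLift Wt c t) = Wt t := by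
  unfold plateauLift
  split_ifs with h
  · exact h.2.symm
  · exact even_apply_abs hWt t

theorem measurable_plateauLift (hWt : Continuous Wt) (c : ℝ) :
    Measurable (plateauLift Wt c) := by
  unfold plateauLift
  refine Measurable.ite ?_ measurable_const measurable_abs
  exact (measurableSet_lt measurable_abs measurable_const).inter
    (measurableSet_eq_fun hWt.measurable measurable_const)

theorem memLp_plateauLift (hWt : Continuous Wt) (c : ℝ) {q : ℝ≥0∞} {F : ℝ → ℝ} (hFm : Measurable F)
    (hF : MemLp F q (rayMeasure N R)) :
    MemLp (fun s => plateauLift Wt c (F s)) q (rayMeasure N R) := by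
  refine (hF.norm.add (memLp_const |c|)).mono
    ((measurable_plateauLift hWt c).comp hFm).aestronglyMeasurable (ae_of_all _ fun s => ?_)
  rw [Real.norm_eq_abs, abs_of_nonneg (plateauLift_nonneg _ _)]
  exact (plateauLift_le _ _).trans (le_abs_self _)

theorem abs_tail_le {F : ℝ → ℝ} (hWt : Continuous Wt) (c : ℝ) (hFm : Measurable F)
    (hF : Integrable F (rayMeasure N R)) {s : ℝ} (hs : 0 < s) :
    |∫ t in Ioo s R, F t| ≤ ∫ t in Ioo s R, |F t| ∧
      ∫ t in Ioo s R, |F t| ≤ ∫ t in Ioo s R, plateauLift Wt c (F t) := by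
  refine ⟨abs_integral_le_integral_abs, ?_⟩
  refine integral_mono (integrableOn_tail hF hFm hs).abs ?_ fun t => abs_le_plateauLift _ _
  refine integrableOn_tail (N := N) ?_ ((measurable_plateauLift hWt c).comp hFm) hs
  exact memLp_one_iff_integrable.1
    (memLp_plateauLift hWt c hFm (memLp_one_iff_integrable.2 hF))

/-- Both halves of the shape condition are used: monotonicity for b ≥ |a|, and the comparison of `G`
at ±a when a < 0. -/
theorem Shape.apply_le (hG : Shape G) {a b : ℝ} (h : |a| ≤ b) : G b ≤ G |a| ∧ G |a| ≤ G a := by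
  refine ⟨hG.1 (mem_Ici.2 (abs_nonneg _)) (mem_Ici.2 ((abs_nonneg _).trans h)) h, ?_⟩
  rcases le_or_gt 0 a with ha | ha
  · rw [abs_of_nonneg ha]
  · rw [abs_of_neg ha]
    simpa using hG.2 (-a) (neg_pos.2 ha)

theorem StrictShape.shape (hG : StrictShape G) : Shape G := ⟨hG.1.antitoneOn, hG.2⟩

theorem radialPrim_neg (F : ℝ → ℝ) (x : Euc N) :
    radialPrim N R (fun s => -F s) x = ∫ t in Ioo ‖x‖ R, F t := by
  rw [radialPrim, integral_neg, neg_neg]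

/-- Raising the modulus of the derivative of the profile along plateaus of `Wt` does not increase
the energy density. -/
theorem density_radialPrim_plateauLift (hN : 1 ≤ N) (hR : 0 < R) (hp : 1 ≤ p) (hWt : Continuous Wt)
    (hWt_even : Function.Even Wt) (hWsym : ∀ ξ, W ξ = Wt ‖ξ‖)
    {F : ℝ → ℝ} (hFm : Measurable F) (hF : MemLp F (ENNReal.ofReal p) (rayMeasure N R)) (c : ℝ) :
    ∀ᵐ x ∂(volume.restrict (Metric.ball (0 : Euc N) R)),
      (W (weakGrad (Metric.ball 0 R) (radialPrim N R fun s => -plateauLift Wt c (F s)) x) +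
          G (radialPrim N R (fun s => -plateauLift Wt c (F s)) x)
        = Wt (F ‖x‖) + G (∫ t in Ioo ‖x‖ R, plateauLift Wt c (F t))) ∧
      W (weakGrad (Metric.ball 0 R) (radialPrim N R F) x) + G (radialPrim N R F x)
        = Wt (F ‖x‖) + G (-∫ t in Ioo ‖x‖ R, F t) ∧
      |-∫ t in Ioo ‖x‖ R, F t| ≤ ∫ t in Ioo ‖x‖ R, plateauLift Wt c (F t) := by
  have hp' : 1 ≤ ENNReal.ofReal p := by simpa using ENNReal.ofReal_le_ofReal hp
  filter_upwards [density_radialPrim (G := G) hN hR hp hWt_even hWsym hFm hF,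
    density_radialPrim (G := G) hN hR hp hWt_even hWsym
      ((measurable_plateauLift hWt c).comp hFm).neg (memLp_plateauLift hWt c hFm hF).neg,
    ae_ne_zero_ball hN] with x h1 h2 hx
  refine ⟨?_, h1, ?_⟩
  · refine h2.trans ?_
    have e : ∀ t, -(plateauLift Wt c ∘ F) t = -plateauLift Wt c (F t) := fun t => rfl
    simp only [profileDensity, Pi.neg_apply, integral_neg, neg_neg, hWt_even _,
      Function.comp_apply, apply_plateauLift hWt_even]
  · rw [abs_neg]
    have h := abs_tail_le hWt c hFm (hF.integrable hp') hx.1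
    exact h.1.trans h.2

/-- The `Wt` term is unchanged, and the new profile dominates the modulus of the old one, so the
shape of `G` makes the density no larger at almost every point. -/
theorem IsMinimizer.lift_profile (hN : 1 ≤ N) (hR : 0 < R) (hp : 1 ≤ p) (hWt : Continuous Wt)
    (hWt_even : Function.Even Wt) (hWsym : ∀ ξ, W ξ = Wt ‖ξ‖) (hG : Shape G)
    {F : ℝ → ℝ} (hFm : Measurable F) (hF : MemLp F (ENNReal.ofReal p) (rayMeasure N R))
    (hmin : IsMinimizer p R W G (radialPrim N R F)) (c : ℝ) :
    IsMinimizer p R W G (radialPrim N R fun s => -plateauLift Wt c (F s)) := by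
  refine ⟨(radialPrim_mem_W01p hN hR hp ((measurable_plateauLift hWt c).comp hFm).neg
    (memLp_plateauLift hWt c hFm hF).neg).1, fun v hv => le_trans ?_ (hmin.2 v hv)⟩
  refine extIntegral_mono ?_
  filter_upwards [density_radialPrim_plateauLift (G := G) hN hR hp hWt hWt_even hWsym hFm hF c]
    with x ⟨h1, h2, h3⟩
  rw [h1, h2]
  have h4 := hG.apply_le h3
  linarith [h4.1, h4.2]

theorem sphereMeasure_neBot (hN : 1 ≤ N) : (ae (sphereMeasure N)).NeBot := by
  rw [ae_neBot]
  intro h0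
  exact sphereArea_ne_zero hN (by rw [sphereArea, h0]; rfl)

/-- Converse of `ae_norm`; one good direction suffices, so P need not be measurable. -/
theorem ae_ray_of_ae_norm (hN : 1 ≤ N) {P : ℝ → Prop}
    (h : ∀ᵐ x ∂(volume.restrict (Metric.ball (0 : Euc N) R)), P ‖x‖) :
    ∀ᵐ s ∂(rayMeasure N R), P s := by
  have := sphereMeasure_neBot hN
  obtain ⟨θ, hθ⟩ := (ae_polar hN h).exists
  filter_upwards [hθ, ae_mem_rayMeasure] with s hs hs0
  rwa [norm_smul, norm_eq_of_mem_sphere θ, mul_one, Real.norm_eq_abs, abs_of_pos hs0.1] at hs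

/-- Under strict monotonicity of `G`, raising the derivative of the profile of a minimizer along
plateaus of `Wt` does not change the modulus of the profile. -/
theorem IsMinimizer.ae_tail_eq (hN : 1 ≤ N) (hR : 0 < R) (hp : 1 ≤ p)
    (hW0 : Continuous W) (hW1 : Coercive p W) (hWt : Continuous Wt)
    (hWt_even : Function.Even Wt) (hWsym : ∀ ξ, W ξ = Wt ‖ξ‖)
    (hG0 : Continuous G) (hG1 : Growth N p G) (hG : StrictShape G)
    {F : ℝ → ℝ} (hFm : Measurable F) (hF : MemLp F (ENNReal.ofReal p) (rayMeasure N R))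
    (hmin : IsMinimizer p R W G (radialPrim N R F)) (c : ℝ) :
    ∀ᵐ s ∂(rayMeasure N R),
      ∫ t in Ioo s R, plateauLift Wt c (F t) = |∫ t in Ioo s R, F t| ∧
        G (-∫ t in Ioo s R, F t) = G |∫ t in Ioo s R, F t| := by
  have hmin' := hmin.lift_profile hN hR hp hWt hWt_even hWsym hG.shape hFm hF c
  have i1 := hmin.integrable_density hN hR hp hW0 hW1 hG0 hG1
  have i2 := hmin'.integrable_density hN hR hp hW0 hW1 hG0 hG1
  have hden := density_radialPrim_plateauLift (G := G) hN hR hp hWt hWt_even hWsym hFm hF c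
  -- Both functions are minimizers, so their energies agree, while the densities are ordered
  -- pointwise; hence the densities agree a.e., and strict monotonicity of `G` identifies the
  -- arguments.
  have heq := le_antisymm (hmin.2 _ hmin'.1) (hmin'.2 _ hmin.1)
  rw [energy, energy, extIntegral_eq_integral i1, extIntegral_eq_integral i2,
    EReal.coe_eq_coe_iff] at heq
  have h0 := sub_eq_zero.2 heq
  rw [← integral_sub i1 i2] at h0
  have h0' := (integral_eq_zero_iff_of_nonneg_ae (hden.mono fun x ⟨h1, h2, h3⟩ => ?_)
    (i1.sub i2)).1 h0
  · refine ae_ray_of_ae_norm (N := N) hN ?_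
    filter_upwards [hden, h0'] with x ⟨h1, h2, h3⟩ h4
    have h5 := hG.shape.apply_le h3
    simp only [Pi.zero_apply, Pi.sub_apply] at h4
    rw [h1, h2] at h4
    rw [abs_neg] at h3 h5
    refine ⟨?_, by linarith [h5.1, h5.2]⟩
    refine (hG.1.injOn (mem_Ici.2 (abs_nonneg _)) (mem_Ici.2 ((abs_nonneg _).trans h3)) ?_).symm
    linarith [h5.1, h5.2]
  · have h5 := hG.shape.apply_le h3
    simp only [Pi.zero_apply, Pi.sub_apply]
    rw [h1, h2]
    linarith [h5.1, h5.2]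

/-- Good starting points s exist arbitrarily close to 0, and countably many of the intervals (s,R)
cover (0,R). -/
theorem ae_of_ae_tail (hR : 0 < R) {P : ℝ → Prop}
    (h : ∀ᵐ s ∂(rayMeasure N R), ∀ᵐ t ∂(volume.restrict (Ioo s R)), P t) :
    ∀ᵐ t ∂(rayMeasure N R), P t := by
  rw [ae_rayMeasure_iff] at h ⊢
  have hex : ∀ n : ℕ, ∃ s ∈ Ioo 0 (min R (1 / ((n : ℝ) + 1))),
      ∀ᵐ t ∂(volume.restrict (Ioo s R)), P t := by
    intro n
    have hpos : 0 < min R (1 / ((n : ℝ) + 1)) := lt_min hR (by positivity)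
    have h1 : ∀ᵐ s ∂(volume.restrict (Ioo 0 (min R (1 / ((n : ℝ) + 1))))),
        s ∈ Ioo 0 (min R (1 / ((n : ℝ) + 1))) ∧ ∀ᵐ t ∂(volume.restrict (Ioo s R)), P t :=
      (ae_restrict_mem measurableSet_Ioo).and (ae_restrict_of_ae_restrict_of_subset
        (Ioo_subset_Ioo_right (min_le_left _ _)) h)
    have hne : (ae ((volume : Measure ℝ).restrict
        (Ioo 0 (min R (1 / ((n : ℝ) + 1)))))).NeBot := by
      rw [ae_neBot, Ne, Measure.restrict_eq_zero, Real.volume_Ioo]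
      simpa using hpos
    exact h1.exists
  choose s hs hsP using hex
  refine ae_restrict_of_ae_restrict_of_subset (t := ⋃ n, Ioo (s n) R) ?_
    ((ae_restrict_iUnion_iff _ _).2 hsP)
  intro t ht
  obtain ⟨n, hn⟩ := exists_nat_one_div_lt ht.1
  exact mem_iUnion.2 ⟨n, ((hs n).2.trans_le (min_le_right _ _)).trans hn, ht.2⟩

/-- The integral of |F| is squeezed between equal quantities, so the nonnegative function
`plateauLift` - |F| has integral 0 over almost every tail. -/
theorem ae_plateauLift_eq_abs (hR : 0 < R) (hWt : Continuous Wt) {F : ℝ → ℝ} (hFm : Measurable F)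
    (hF : Integrable F (rayMeasure N R)) (c : ℝ)
    (h : ∀ᵐ s ∂(rayMeasure N R),
      ∫ t in Ioo s R, plateauLift Wt c (F t) = |∫ t in Ioo s R, F t|) :
    ∀ᵐ s ∂(rayMeasure N R), plateauLift Wt c (F s) = |F s| := by
  refine ae_of_ae_tail hR ?_
  filter_upwards [h, ae_mem_rayMeasure] with s hs hs0
  have h1 := abs_tail_le hWt c hFm hF hs0.1
  have i1 : IntegrableOn (fun t => plateauLift Wt c (F t)) (Ioo s R) := by
    refine integrableOn_tail (N := N) ?_ ((measurable_plateauLift hWt c).comp hFm) hs0.1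
    exact memLp_one_iff_integrable.1
      (memLp_plateauLift hWt c hFm (memLp_one_iff_integrable.2 hF))
  have i2 := (integrableOn_tail hF hFm hs0.1).abs
  have h2 : ∫ t in Ioo s R, (plateauLift Wt c (F t) - |F t|) = 0 := by
    rw [integral_sub i1 i2]
    linarith [h1.1, h1.2]
  rw [integral_eq_zero_iff_of_nonneg (fun t => sub_nonneg.2 (abs_le_plateauLift c (F t)))
    (i1.sub i2)] at h2
  filter_upwards [h2] with t ht
  exact sub_eq_zero.1 ht

/-- If `|∫_s^R F| = ∫_s^R |F|` for a.e. `s`, then `s ↦ ∫_s^R F` has constant sign. -/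
theorem tail_constant_sign {F : ℝ → ℝ} (hFm : Measurable F)
    (hF : Integrable F (rayMeasure N R))
    (h : ∀ᵐ s ∂(rayMeasure N R), ∫ t in Ioo s R, |F t| = |∫ t in Ioo s R, F t|) :
    (∀ᵐ s ∂(rayMeasure N R), 0 ≤ ∫ t in Ioo s R, F t) ∨
      (∀ᵐ s ∂(rayMeasure N R), ∫ t in Ioo s R, F t ≤ 0) := by
  -- If the tail of K from s₁ is nonnegative, then |K| - K has integral 0 over (s₁,R), hence also
  -- over (s₂,R); so the tail from s₂ equals that of |K|. Thus a sign at one point persists towards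
  -- R.
  have key : ∀ K : ℝ → ℝ, (∀ s ∈ Ioo 0 R, IntegrableOn K (Ioo s R)) →
      ∀ s₁ ∈ Ioo 0 R, ∀ s₂ ∈ Ioo 0 R, s₁ ≤ s₂ → ∫ t in Ioo s₁ R, |K t| = |∫ t in Ioo s₁ R, K t| →
      0 ≤ ∫ t in Ioo s₁ R, K t → 0 ≤ ∫ t in Ioo s₂ R, K t := by
    intro K hK s₁ hs₁ s₂ hs₂ hle heq hpos
    rw [abs_of_nonneg hpos] at heq
    have i1 := hK s₁ hs₁
    have i2 := hK s₂ hs₂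
    have h1 : ∫ t in Ioo s₂ R, (|K t| - K t) ≤ ∫ t in Ioo s₁ R, (|K t| - K t) :=
      setIntegral_mono_set (i1.abs.sub i1) (ae_of_all _ fun t => sub_nonneg.2 (le_abs_self _))
        (LE.le.eventuallyLE (Ioo_subset_Ioo_left hle))
    rw [integral_sub i1.abs i1, integral_sub i2.abs i2, heq, sub_self] at h1
    have h2 : 0 ≤ ∫ t in Ioo s₂ R, |K t| := integral_nonneg fun t => abs_nonneg _
    linarith
  have hK : ∀ s ∈ Ioo 0 R, IntegrableOn F (Ioo s R) :=
    fun s hs => integrableOn_tail hF hFm hs.1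
  have keyneg : ∀ s₁ ∈ Ioo 0 R, ∀ s₂ ∈ Ioo 0 R, s₁ ≤ s₂ →
      ∫ t in Ioo s₁ R, |F t| = |∫ t in Ioo s₁ R, F t| →
      ∫ t in Ioo s₁ R, F t ≤ 0 → ∫ t in Ioo s₂ R, F t ≤ 0 := by
    intro s₁ hs₁ s₂ hs₂ hle heq hneg
    have := key (fun t => -F t) (fun s hs => (hK s hs).neg) s₁ hs₁ s₂ hs₂ hle
      (by simpa [integral_neg] using heq) (by simpa [integral_neg] using hneg)
    simpa [integral_neg] using this
  -- Of two points with opposite strict signs, the one nearer to 0 would impose its sign on the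
  -- other.
  by_cases hex : ∃ s ∈ Ioo 0 R, ∫ t in Ioo s R, |F t| = |∫ t in Ioo s R, F t| ∧
      ∫ t in Ioo s R, F t < 0
  · obtain ⟨s₀, hs₀, heq₀, hlt₀⟩ := hex
    right
    filter_upwards [h, ae_mem_rayMeasure] with s hs hs0
    by_contra! hcon
    rcases le_total s s₀ with hle | hle
    · exact absurd (key F hK s hs0 s₀ hs₀ hle hs hcon.le) (not_le.2 hlt₀)
    · exact absurd (keyneg s₀ hs₀ s hs0 hle heq₀ hlt₀.le) (not_le.2 hcon)
  · left
    filter_upwards [h, ae_mem_rayMeasure] with s hs hs0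
    by_contra! hcon
    exact hex ⟨s, hs0, hs, hcon⟩

theorem le_plateauLift {M₀ : ℝ} (hconst : ∀ s ∈ Icc (-M₀) M₀, ∀ t ∈ Icc (-M₀) M₀, Wt s = Wt t)
    (t : ℝ) : M₀ ≤ plateauLift Wt M₀ t := by
  unfold plateauLift
  split_ifs with h
  · exact le_rfl
  · by_contra! hlt
    have h0 : 0 ≤ M₀ := (abs_nonneg t).trans hlt.le
    exact h ⟨hlt, hconst t (abs_le.1 hlt.le) M₀ ⟨by linarith, le_rfl⟩⟩

end Plateau

/-! ### Symmetry and monotonicity of minimizers -/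

section Symmetry

variable {N : ℕ} {R p : ℝ} {W : Euc N → ℝ} {Wt G : ℝ → ℝ}

theorem exists_measurable_radialDeriv {u : Euc N → ℝ} (hu : u ∈ W01p p (Metric.ball 0 R)) :
    ∃ F : Euc N → ℝ, Measurable F ∧ radialDeriv R u =ᵐ[volume.restrict (Metric.ball 0 R)] F := by
  have h : AEStronglyMeasurable (radialDeriv R u) (volume.restrict (Metric.ball 0 R)) := by
    refine AEStronglyMeasurable.inner hu.1.2.2.1 ?_
    exact Measurable.aestronglyMeasurable (by fun_prop)
  exact ⟨h.mk _, h.stronglyMeasurable_mk.measurable, h.ae_eq_mk⟩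

/-- If |∂_r u| < |∇u|, then (*) would make `Wt` strictly larger at |∇u|, against W(∇u) = Wt(∂_r u).
Equality in Cauchy–Schwarz then makes the gradient radial. -/
theorem weakGrad_radial_of_strictIncreaseAt (hN : 1 ≤ N)
    (hWt_even : Function.Even Wt) (hWsym : ∀ ξ, W ξ = Wt ‖ξ‖)
    {u F : Euc N → ℝ} (hF : radialDeriv R u =ᵐ[volume.restrict (Metric.ball 0 R)] F)
    (hW : ∀ᵐ x ∂(volume.restrict (Metric.ball (0 : Euc N) R)),
      W (weakGrad (Metric.ball 0 R) u x) = Wt (F x))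
    (hs : StrictIncreaseAt R Wt u) :
    ∀ᵐ x ∂(volume.restrict (Metric.ball (0 : Euc N) R)),
      weakGrad (Metric.ball 0 R) u x = radialDeriv R u x • (‖x‖⁻¹ • x) := by
  filter_upwards [hF, hW, hs, ae_ne_zero_ball hN] with x h1 h2 h3 hx
  set g := weakGrad (Metric.ball 0 R) u x with hg
  set e := ‖x‖⁻¹ • x with he
  have he1 : ‖e‖ = 1 := norm_unit hx.1
  have hle : |radialDeriv R u x| ≤ ‖g‖ := abs_inner_unit_le _ _
  have heq : |radialDeriv R u x| = ‖g‖ := by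
    by_contra hne
    have h4 := h3 ‖g‖ (by rw [abs_of_nonneg (norm_nonneg g)]; exact lt_of_le_of_ne hle hne)
    rw [abs_of_nonneg (norm_nonneg g), even_apply_abs hWt_even, h1, ← h2, hWsym] at h4
    exact lt_irrefl _ h4
  have hr : radialDeriv R u x = inner ℝ g e := rfl
  have h5 : ‖g - radialDeriv R u x • e‖ ^ 2 = 0 := by
    rw [norm_sub_sq_real, real_inner_smul_right, ← hr, norm_smul, he1, mul_one, ← heq,
      Real.norm_eq_abs, sq_abs]
    ring
  exact sub_eq_zero.1 (norm_eq_zero.1 (pow_eq_zero_iff two_ne_zero |>.1 h5))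

/-- A radially symmetric minimizer is given by the profile along some ray. -/
theorem IsMinimizer.exists_profile (hN : 1 ≤ N) (hR : 0 < R) (hp : 1 ≤ p)
    (hW0 : Continuous W) (hW1 : Coercive p W) (hWt : Continuous Wt)
    (hWt_even : Function.Even Wt) (hWsym : ∀ ξ, W ξ = Wt ‖ξ‖)
    (hG0 : Continuous G) (hG1 : Growth N p G) (hWt_mono : MonotoneOn Wt (Ici 0))
    {u : Euc N → ℝ} (hu : IsMinimizer p R W G u) (hrad : IsRadial R u) :
    ∃ F : ℝ → ℝ, Measurable F ∧ MemLp F (ENNReal.ofReal p) (rayMeasure N R) ∧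
      IsMinimizer p R W G (radialPrim N R F) ∧
      u =ᵐ[volume.restrict (Metric.ball 0 R)] radialPrim N R F := by
  obtain ⟨F, hFm, hF⟩ := exists_measurable_radialDeriv hu.1
  have hray := (hu.ae_ray hN hR hp hW0 hW1 hWt hWt_even hWsym hG0 hG1 hWt_mono hFm hF).2
  obtain ⟨f, hf⟩ := hrad
  have := sphereMeasure_neBot hN
  obtain ⟨θ, ⟨h1, h2, h3⟩, h4⟩ := (hray.and (ae_polar hN hf)).exists
  refine ⟨fun s => F (s • (θ : Euc N)), by fun_prop, h1, h3, ?_⟩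
  have h5 : ∀ᵐ s ∂(rayMeasure N R), f s = -∫ t in Ioo s R, F (t • (θ : Euc N)) := by
    filter_upwards [h2, h4, ae_mem_rayMeasure] with s hs hs' hs0
    rw [norm_smul, norm_eq_of_mem_sphere θ, mul_one, Real.norm_eq_abs, abs_of_pos hs0.1] at hs'
    rw [← hs, hs']
  filter_upwards [hf, ae_norm hN h5] with x hx hx'
  rw [hx, hx']
  rfl

theorem isRadial_radialPrim (F : ℝ → ℝ) : IsRadial R (radialPrim N R F) :=
  ⟨fun r => -∫ t in Ioo r R, F t, ae_of_all _ fun _ => rfl⟩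

theorem IsMinimizer.isRadial_of_strictIncreaseAt (hN : 2 ≤ N) (hR : 0 < R) (hp : 1 ≤ p)
    (hW0 : Continuous W) (hW1 : Coercive p W) (hWt : Continuous Wt)
    (hWt_even : Function.Even Wt) (hWsym : ∀ ξ, W ξ = Wt ‖ξ‖)
    (hG0 : Continuous G) (hG1 : Growth N p G) (hWt_mono : MonotoneOn Wt (Ici 0))
    {u : Euc N → ℝ} (hu : IsMinimizer p R W G u) (hs : StrictIncreaseAt R Wt u) :
    IsRadial R u := by
  have hN1 : 1 ≤ N := by omega
  obtain ⟨F, hFm, hF⟩ := exists_measurable_radialDeriv hu.1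
  have hW := (hu.ae_ray hN1 hR hp hW0 hW1 hWt hWt_even hWsym hG0 hG1 hWt_mono hFm hF).1
  exact isRadial_of_weakGrad_radial hN hp hu.1
    (weakGrad_radial_of_strictIncreaseAt hN1 hWt_even hWsym hF hW hs)

/-- Almost every ray is the profile of a minimizer, and there no lift can change |F|. Radial
symmetry of u is not yet known, so the argument runs ray by ray. -/
theorem IsMinimizer.strictIncreaseAt (hN : 1 ≤ N) (hR : 0 < R) (hp : 1 ≤ p)
    (hW0 : Continuous W) (hW1 : Coercive p W) (hWt : Continuous Wt)
    (hWt_even : Function.Even Wt) (hWsym : ∀ ξ, W ξ = Wt ‖ξ‖)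
    (hG0 : Continuous G) (hG1 : Growth N p G) (hWt_mono : MonotoneOn Wt (Ici 0))
    (hG : StrictShape G) {u : Euc N → ℝ} (hu : IsMinimizer p R W G u) :
    StrictIncreaseAt R Wt u := by
  have hp' : 1 ≤ ENNReal.ofReal p := by simpa using ENNReal.ofReal_le_ofReal hp
  obtain ⟨F, hFm, hF⟩ := exists_measurable_radialDeriv hu.1
  have hray := (hu.ae_ray hN hR hp hW0 hW1 hWt hWt_even hWsym hG0 hG1 hWt_mono hFm hF).2
  -- Rational levels keep the exceptional set null; monotonicity of `Wt` recovers all real ν.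
  have hae : ∀ᵐ x ∂(volume.restrict (Metric.ball (0 : Euc N) R)),
      ∀ q : ℚ, plateauLift Wt q (F x) = |F x| := by
    refine ae_all_iff.2 fun q => ae_of_ae_polar hN ?_ ?_
    · exact measurableSet_eq_fun ((measurable_plateauLift hWt q).comp hFm) hFm.abs
    · filter_upwards [hray] with θ ⟨h1, _, h3⟩
      have hm : Measurable fun s : ℝ => F (s • (θ : Euc N)) := by fun_prop
      refine ae_plateauLift_eq_abs hR hWt hm (h1.integrable hp') q ?_
      exact (h3.ae_tail_eq hN hR hp hW0 hW1 hWt hWt_even hWsym hG0 hG1 hG hm h1 q).mono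
        fun s hs => hs.1
  filter_upwards [hF, hae] with x hx hxq ν hν
  rw [hx] at hν ⊢
  obtain ⟨q, hq1, hq2⟩ := exists_rat_btwn hν
  have hq0 : (0 : ℝ) ≤ q := (abs_nonneg _).trans hq1.le
  -- If the values agreed, the lift at level q would raise |F x| to q.
  have hne : Wt (F x) ≠ Wt q := by
    intro heq
    have h := hxq q
    rw [plateauLift, if_pos ⟨hq1, heq⟩] at h
    exact hq1.ne' h
  rw [even_apply_abs hWt_even (F x)]
  have h1 : Wt (F x) ≤ Wt q := by
    rw [← even_apply_abs hWt_even (F x)]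
    exact hWt_mono (mem_Ici.2 (abs_nonneg _)) (mem_Ici.2 hq0) hq1.le
  exact (lt_of_le_of_ne h1 hne).trans_le
    (hWt_mono (mem_Ici.2 hq0) (mem_Ici.2 (abs_nonneg _)) hq2.le)

theorem radialDeriv_plateauLift_le (hN : 1 ≤ N) (hR : 0 < R) (hp : 1 ≤ p) (hWt : Continuous Wt)
    {M₀ : ℝ} (hconst : ∀ s ∈ Icc (-M₀) M₀, ∀ t ∈ Icc (-M₀) M₀, Wt s = Wt t)
    {F : ℝ → ℝ} (hFm : Measurable F) (hF : MemLp F (ENNReal.ofReal p) (rayMeasure N R)) :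
    ∀ᵐ x ∂(volume.restrict (Metric.ball (0 : Euc N) R)),
      radialDeriv R (radialPrim N R fun s => -plateauLift Wt M₀ (F s)) x ≤ -M₀ := by
  filter_upwards [radialDeriv_radialPrim hN hR hp ((measurable_plateauLift hWt M₀).comp hFm).neg
    (memLp_plateauLift hWt M₀ hFm hF).neg] with x hx
  refine le_of_eq_of_le hx ?_
  simpa using le_plateauLift hconst (F ‖x‖)

theorem isRadiallyDecreasing_of_profile {u : Euc N → ℝ} {K : ℝ → ℝ} (hKm : Measurable K)
    (hK : Integrable K (rayMeasure N R)) (hK0 : ∀ t, 0 ≤ K t)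
    (hu : ∀ᵐ x ∂(volume.restrict (Metric.ball (0 : Euc N) R)), u x = ∫ t in Ioo ‖x‖ R, K t) :
    IsRadiallyDecreasing R u := by
  refine ⟨fun r => ∫ t in Ioo r R, K t, fun a ha b hb hab => ?_, hu⟩
  exact setIntegral_mono_set (integrableOn_tail hK hKm ha.1) (ae_of_all _ hK0)
    (LE.le.eventuallyLE (Ioo_subset_Ioo_left hab))

end Symmetry

end

end RadialMin

/-! ### The three assertions combined -/

theorem mainTheorem2 (N : ℕ) (hN : 2 ≤ N) (R p : ℝ) (hR : 0 < R) (hp : 1 < p)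
    (W : RadialMin.Euc N → ℝ) (Wt G : ℝ → ℝ)
    (hW0 : Continuous W) (hW1 : RadialMin.Coercive p W)
    (hWt : Continuous Wt) (hWt_even : Function.Even Wt) (hWsym : ∀ ξ, W ξ = Wt ‖ξ‖)
    (hG0 : Continuous G) (hG1 : RadialMin.Growth N p G)
    (hWt_mono : MonotoneOn Wt (Set.Ici 0))
    (hmin : ∃ u, RadialMin.IsMinimizer p R W G u)
    (M₀ : ℝ) (hM₀ : 0 ≤ M₀)
    (hconst : ∀ s ∈ Set.Icc (-M₀) M₀, ∀ t ∈ Set.Icc (-M₀) M₀, Wt s = Wt t) :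
    -- (i)
    ((∃ u, RadialMin.IsMinimizer p R W G u ∧ RadialMin.IsRadial R u) ∧
      (RadialMin.Shape G →
        ∃ u, RadialMin.IsMinimizer p R W G u ∧ RadialMin.IsRadial R u ∧
          (∀ᵐ x ∂(volume.restrict (Metric.ball (0 : RadialMin.Euc N) R)), 0 ≤ u x) ∧
          (∀ᵐ x ∂(volume.restrict (Metric.ball (0 : RadialMin.Euc N) R)),
            RadialMin.radialDeriv R u x ≤ -M₀))) ∧
    -- (ii)
    (∀ u, RadialMin.IsMinimizer p R W G u → RadialMin.StrictIncreaseAt R Wt u →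
      RadialMin.IsRadial R u) ∧
    -- (iii)
    (RadialMin.StrictShape G →
      ∀ u, RadialMin.IsMinimizer p R W G u →
        RadialMin.StrictIncreaseAt R Wt u ∧
        RadialMin.IsRadial R u ∧
        ((∀ᵐ x ∂(volume.restrict (Metric.ball (0 : RadialMin.Euc N) R)), 0 ≤ u x) ∨
          (∀ᵐ x ∂(volume.restrict (Metric.ball (0 : RadialMin.Euc N) R)), u x ≤ 0)) ∧
        ((∀ᵐ x ∂(volume.restrict (Metric.ball (0 : RadialMin.Euc N) R)), u x ≤ 0) →
          (∀ᵐ x ∂(volume.restrict (Metric.ball (0 : RadialMin.Euc N) R)),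
            G (u x) = G (-u x)) ∧
          RadialMin.IsMinimizer p R W G (fun x => |u x|)) ∧
        ((∀ᵐ x ∂(volume.restrict (Metric.ball (0 : RadialMin.Euc N) R)), 0 ≤ u x) →
          (∀ᵐ x ∂(volume.restrict (Metric.ball (0 : RadialMin.Euc N) R)),
            RadialMin.radialDeriv R u x ≤ -M₀) ∧
          RadialMin.IsRadiallyDecreasing R u)) := by
  open RadialMin in
  have hN1 : 1 ≤ N := by omega
  have hp1 : 1 ≤ p := hp.le
  have hp' : 1 ≤ ENNReal.ofReal p := by simpa using ENNReal.ofReal_le_ofReal hp1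
  have hprofile : ∃ F : ℝ → ℝ, Measurable F ∧
      MemLp F (ENNReal.ofReal p) (rayMeasure N R) ∧ IsMinimizer p R W G (radialPrim N R F) := by
    obtain ⟨u, hu⟩ := hmin
    obtain ⟨F, hFm, hF⟩ := exists_measurable_radialDeriv hu.1
    have hray := (hu.ae_ray hN1 hR hp1 hW0 hW1 hWt hWt_even hWsym hG0 hG1 hWt_mono hFm hF).2
    have := sphereMeasure_neBot hN1
    obtain ⟨θ, h1, -, h3⟩ := hray.exists
    exact ⟨_, by fun_prop, h1, h3⟩
  refine ⟨⟨?_, fun hG => ?_⟩, fun u hu hs => ?_, fun hG u hu => ?_⟩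
  · obtain ⟨F, -, -, h⟩ := hprofile
    exact ⟨_, h, isRadial_radialPrim F⟩
  · obtain ⟨F, hFm, hF, h⟩ := hprofile
    refine ⟨_, h.lift_profile hN1 hR hp1 hWt hWt_even hWsym hG hFm hF M₀, isRadial_radialPrim _,
      ae_of_all _ fun x => ?_, radialDeriv_plateauLift_le hN1 hR hp1 hWt hconst hFm hF⟩
    rw [radialPrim_neg]
    exact integral_nonneg fun t => plateauLift_nonneg _ _
  · exact hu.isRadial_of_strictIncreaseAt hN hR hp1 hW0 hW1 hWt hWt_even hWsym hG0 hG1 hWt_mono hs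
  · have hs := hu.strictIncreaseAt hN1 hR hp1 hW0 hW1 hWt hWt_even hWsym hG0 hG1 hWt_mono hG
    have hrad := hu.isRadial_of_strictIncreaseAt hN hR hp1 hW0 hW1 hWt hWt_even hWsym hG0 hG1
      hWt_mono hs
    obtain ⟨F, hFm, hF, hFmin, huF⟩ := hu.exists_profile hN1 hR hp1 hW0 hW1 hWt hWt_even hWsym
      hG0 hG1 hWt_mono hrad
    -- The single level M₀ serves for the sign, for |u| and for the slope bound.
    have htail := hFmin.ae_tail_eq hN1 hR hp1 hW0 hW1 hWt hWt_even hWsym hG0 hG1 hG hFm hF M₀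
    have hlift := hFmin.lift_profile hN1 hR hp1 hWt hWt_even hWsym hG.shape hFm hF M₀
    have hx := ae_norm hN1 htail
    -- By strictness of `G` the lifted minimizer is |u| itself.
    have habs : (fun x => |u x|) =ᵐ[volume.restrict (Metric.ball (0 : Euc N) R)]
        radialPrim N R fun s => -plateauLift Wt M₀ (F s) := by
      filter_upwards [hx, huF] with x h1 h2
      rw [radialPrim_neg, h1.1, h2, radialPrim, abs_neg]
    refine ⟨hs, hrad, ?_, fun hneg => ⟨?_, ?_⟩, fun hpos => ?_⟩
    · have h1 : ∀ᵐ s ∂(rayMeasure N R), ∫ t in Ioo s R, |F t| = |∫ t in Ioo s R, F t| := by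
        filter_upwards [htail, ae_mem_rayMeasure] with s hs1 hs0
        have h2 := abs_tail_le hWt M₀ hFm (hF.integrable hp') hs0.1
        exact le_antisymm (h2.2.trans hs1.1.le) h2.1
      rcases tail_constant_sign hFm (hF.integrable hp') h1 with h | h
      · right
        filter_upwards [huF, ae_norm hN1 h] with x h2 h3
        rw [h2, radialPrim]
        linarith
      · left
        filter_upwards [huF, ae_norm hN1 h] with x h2 h3
        rw [h2, radialPrim]
        linarith
    · filter_upwards [hneg, hx, huF] with x h1 h2 h3
      have h4 : u x = -∫ t in Ioo ‖x‖ R, F t := h3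
      have h5 := h2.2
      rw [← abs_neg, ← h4, abs_of_nonpos h1] at h5
      exact h5
    · exact hlift.congr hp1 habs.symm
    -- For u ≥ 0 the function u = |u| coincides with the lifted profile, whose slope is at most -M₀
    -- by construction.
    · have hueq : u =ᵐ[volume.restrict (Metric.ball (0 : Euc N) R)]
          radialPrim N R fun s => -plateauLift Wt M₀ (F s) := by
        filter_upwards [habs, hpos] with x h1 h2
        rw [← h1, abs_of_nonneg h2]
      constructor
      · have hg := (W01p_congr Metric.isOpen_ball measure_ball_lt_top.ne hp1 hlift.1
          hueq.symm).2
        filter_upwards [hg, radialDeriv_plateauLift_le hN1 hR hp1 hWt hconst hFm hF] with x h1 h2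
        rw [radialDeriv, h1]
        exact h2
      · refine isRadiallyDecreasing_of_profile ((measurable_plateauLift hWt M₀).comp hFm)
          ((memLp_plateauLift hWt M₀ hFm hF).integrable hp') (fun t => plateauLift_nonneg _ _) ?_
        filter_upwards [hueq] with x h1
        rw [h1, radialPrim_neg]
        rfl
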